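/- Let $H_1,H_2$ be real separable Hilbert spaces with $\dim H_1=\infty$, and let all random variables be defined on one probability space $(\Omega,\mathcal A,P)$. For $x\in H_i$, $y\in H_j$ write $x\otimes y$ for the operator $v\mapsto\langle x,v\rangle y$, and $\|\cdot\|_{\mathcal L}$ for the operator norm. Consider the model $$Y_k=\Psi(X_k)+\varepsilon_k,\qquad k\ge 1,$$ with a bounded linear operator $\Psi:H_1\to H_2$, where: (A) $(X_k)_{k\ge1}$ in $H_1$ and $(\varepsilon_k)_{k\ge1}$ in $H_2$ have mean zero and are $L^4$–$m$–approximable with respect to a common innovation sequence. That is, there are i.i.d. random elements $(\delta_i)_{i\in\mathbb Z}$ of a measurable space $S$, an independent copy $(\delta_i')_{i\in\mathbb Z}$ of this sequence, and measurable maps $f:S^{\mathbb N}\to H_1$, $g:S^{\mathbb N}\to H_2$ such that $X_n=f(\delta_n,\delta_{n-1},\dots)$ and $\varepsilon_n=g(\delta_n,\delta_{n-1},\dots)$ almost surely, $E\|X_n\|^4<\infty$ and $E\|\varepsilon_n\|^4<\infty$ for $n\ge 1$, and $$\sum_{m\ge1}\big(E\|X_m-X_m^{(m)}\|^4\big)^{1/4}<\infty,\qquad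 \sum_{m\ge1}\big(E\|\varepsilon_m-\varepsilon_m^{(m)}\|^4\big)^{1/4}<\infty,$$ where $X_m^{(m)}=f(\delta_m,\dots,\delta_1,\delta_0',\delta_{-1}',\dots)$ and $\varepsilon_m^{(m)}=g(\delta_m,\dots,\delta_1,\delta_0',\delta_{-1}',\dots)$. Moreover $(\varepsilon_k)$ is $H_2$–white noise (that is, $E[\varepsilon_j\otimes\varepsilon_k]=0$ for $j\ne k$, with mean and covariance operator not depending on $k$), and $X_k\perp\varepsilon_k$, i.e. $E[X_k\otimes\varepsilon_k]=0$, for every $k\ge1$. Suppose that the covariance operator $C=E[X_1\otimes X_1]$ has dense range in $H_1$, that its eigenvalues $\lambda_1\ge\lambda_2\ge\cdots$, listed with multiplicity, are mutually distinct, and that $\Psi$ is a Hilbert–Schmidt operator. Let $\hat C_n=\frac1n\sum_{k=1}^nX_k\otimes X_k$ and $\hat\Delta_n=\frac1n\sum_{k=1}^nX_k\otimes Y_k$. Let $\hat\lambda_1\ge\hat\lambda_2\ge\cdots\ge 0$ be the eigenvalues of $\hat C_n$, listed with multiplicity, with any choice of corresponding orthonormal eigenvectors $\hat v_1,\hat v_2,\dots$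 (all depending on $n$). Put $\hat\alpha_1=\hat\lambda_1-\hat\lambda_2$ and $\hat\alpha_j=\min\{\hat\lambda_{j-1}-\hat\lambda_j,\ \hat\lambda_j-\hat\lambda_{j+1}\}$ for $j>1$, and $$\hat\Psi_K(x)=\sum_{j=1}^K\frac{\hat\Delta_n(\hat v_j)}{\hat\lambda_j}\langle\hat v_j,x\rangle .$$ (K) Let $m_n$ be real numbers with $m_n\to\infty$ and $m_n^6=o(n)$, and let $K_n=\min(B_n,E_n,\lfloor m_n\rfloor)$, where $$B_n=\max\{j\ge1:\hat\lambda_j^{-1}\le m_n\},\qquad E_n=\max\Big\{k\ge1:\max_{1\le j\le k}\hat\alpha_j^{-1}\le m_n\Big\},$$ with $0^{-1}=\infty$ and $\max\emptyset=0$. Then $\|\hat\Psi_{K_n}-\Psi\|_{\mathcal L}\to0$ in probability as $n\to\infty$. -/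

import Mathlib

open MeasureTheory ProbabilityTheory Filter Topology Asymptotics
open scoped ENNReal

noncomputable section

namespace HilbertLM

section Operators

variable {H H₁ H₂ : Type*}
  [NormedAddCommGroup H] [InnerProductSpace ℝ H]
  [NormedAddCommGroup H₁] [InnerProductSpace ℝ H₁]
  [NormedAddCommGroup H₂] [InnerProductSpace ℝ H₂]

/-- `x ⊗ y`, the operator `v ↦ ⟪x, v⟫ y`. -/
def tensor (x : H₁) (y : H₂) : H₁ →L[ℝ] H₂ := InnerProductSpace.rankOne ℝ y x

/-- `Φ` is Hilbert–Schmidt: `∑ ‖Φ e‖² < ∞` along orthonormal bases `(e)` of the domain. -/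
def IsHilbertSchmidt (Φ : H₁ →L[ℝ] H₂) : Prop :=
  ∀ (s : Set H₁) (e : HilbertBasis s ℝ H₁), Summable fun i => ‖Φ (e i)‖ ^ 2

/-- `(lam j, v j)`, `j = 0, 1, 2, …`, lists the eigenvalues of `T` in decreasing order together
with corresponding orthonormal eigenvectors, every nonzero eigenvalue being repeated according to
its multiplicity. If `T` is positive of finite rank `r` on an infinite dimensional space, then
`lam j = 0` for all `j ≥ r`. Indices start at `0`: the `j`-th largest
eigenvalue, `j ≥ 1`, is `lam (j - 1)`. -/
structure IsEigenSystem (T : H →L[ℝ] H) (lam : ℕ → ℝ) (v : ℕ → H) : Prop where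
  orthonormal : Orthonormal ℝ v
  eigen : ∀ j, T (v j) = lam j • v j
  antitone : Antitone lam
  complete : ∀ μ : ℝ, μ ≠ 0 → ∀ x, T x = μ • x → x ∈ Submodule.span ℝ (v '' {j | lam j = μ})

/-- The spectral gaps: `α_1 = λ_1 - λ_2` and `α_j = min (λ_{j-1} - λ_j) (λ_j - λ_{j+1})` for
`j > 1` (the code is indexed from `0`). -/
def gap (lam : ℕ → ℝ) : ℕ → ℝ
  | 0 => lam 0 - lam 1
  | j + 1 => min (lam j - lam (j + 1)) (lam (j + 1) - lam (j + 2))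

/-- `B = max {j ≥ 1 | λ_j⁻¹ ≤ m}` where `0⁻¹ = ∞`; it is `0` if there is no such `j`. -/
def truncB (lam : ℕ → ℝ) (m : ℝ) : ℕ :=
  sSup {j : ℕ | 1 ≤ j ∧ 0 < lam (j - 1) ∧ (lam (j - 1))⁻¹ ≤ m}

/-- `E = max {k ≥ 1 | max_{1 ≤ j ≤ k} α_j⁻¹ ≤ m}` where `0⁻¹ = ∞`; it is `0` if there is no
such `k`. -/
def truncE (lam : ℕ → ℝ) (m : ℝ) : ℕ :=
  sSup {k : ℕ | 1 ≤ k ∧ ∀ j < k, 0 < gap lam j ∧ (gap lam j)⁻¹ ≤ m}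

/-- `K = min (B, E, m)`, with `m` rounded down to an integer. -/
def truncK (lam : ℕ → ℝ) (m : ℝ) : ℕ :=
  min (min (truncB lam m) (truncE lam m)) ⌊m⌋₊

/-- `∑_{j=1}^K v_j ⊗ (λ_j⁻¹ D(v_j))`, i.e. the operator `x ↦ ∑_{j=1}^K (D(v_j) / λ_j) ⟪v_j, x⟫`. -/
def pcaOperator (D : H₁ →L[ℝ] H₂) (lam : ℕ → ℝ) (v : ℕ → H₁) (K : ℕ) : H₁ →L[ℝ] H₂ :=
  ∑ j ∈ Finset.range K, tensor (v j) ((lam j)⁻¹ • D (v j))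

end Operators

section Probability

variable {Ω H H₁ H₂ S : Type*} [MeasurableSpace Ω] [MeasurableSpace S]
  [NormedAddCommGroup H] [InnerProductSpace ℝ H]
  [NormedAddCommGroup H₁] [InnerProductSpace ℝ H₁]
  [NormedAddCommGroup H₂] [InnerProductSpace ℝ H₂]

/-- `E[X ⊗ Y]` (a Bochner integral in the operator norm). -/
def crossMoment (P : Measure Ω) (X : Ω → H₁) (Y : Ω → H₂) : H₁ →L[ℝ] H₂ :=
  ∫ ω, tensor (X ω) (Y ω) ∂P

/-- The covariance operator `E[(X - EX) ⊗ (X - EX)]`. -/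
def covOp (P : Measure Ω) (X : Ω → H) : H →L[ℝ] H :=
  crossMoment P (fun ω => X ω - ∫ ω', X ω' ∂P) (fun ω => X ω - ∫ ω', X ω' ∂P)

/-- `X ⊥ Y`: both have two moments and `E[X ⊗ Y] = 0`. -/
def Orthogonal (P : Measure Ω) (X : Ω → H₁) (Y : Ω → H₂) : Prop :=
  MemLp X 2 P ∧ MemLp Y 2 P ∧ crossMoment P X Y = 0

/-- `(ε_k)_{k ≥ 1}` is `H`-white noise: pairwise orthogonal, with constant mean and constant
covariance operator. -/
structure IsWhiteNoise (P : Measure Ω) (ε : ℕ → Ω → H) : Prop where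
  memLp : ∀ k, 1 ≤ k → MemLp (ε k) 2 P
  orthogonal : ∀ j k, 1 ≤ j → 1 ≤ k → j ≠ k → Orthogonal P (ε j) (ε k)
  mean_const : ∀ k, 1 ≤ k → ∫ ω, ε k ω ∂P = ∫ ω, ε 1 ω ∂P
  cov_const : ∀ k, 1 ≤ k → covOp P (ε k) = covOp P (ε 1)

/-- `(δ_i)_{i ∈ ℤ}` is i.i.d. and `(δ'_i)_{i ∈ ℤ}` is an independent copy of it. -/
structure IsIIDWithCopy (P : Measure Ω) (δ δ' : ℤ → Ω → S) : Prop where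
  measurable : ∀ i, Measurable (δ i)
  measurable_copy : ∀ i, Measurable (δ' i)
  indep : iIndepFun (Sum.elim δ δ') P
  identDistrib : ∀ i, IdentDistrib (δ i) (δ 0) P P
  identDistrib_copy : ∀ i, IdentDistrib (δ' i) (δ 0) P P

/-- The sequence `(δ_n, δ_{n-1}, δ_{n-2}, …)`. -/
def past (δ : ℤ → Ω → S) (n : ℤ) (ω : Ω) : ℕ → S := fun i => δ (n - i) ω

/-- The sequence `(δ_n, …, δ_{n-m+1}, δ'_{n-m}, δ'_{n-m-1}, …)`. -/
def coupledPast (δ δ' : ℤ → Ω → S) (n : ℤ) (m : ℕ) (ω : Ω) : ℕ → S :=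
  fun i => if i < m then δ (n - i) ω else δ' (n - i) ω

/-- `(X_n)_{n ≥ 1}` is `L^p`-`m`-approximable with the representation `X_n = f(δ_n, δ_{n-1}, …)`,
where `δ'` is the copy of `δ`: the `X_n` have `p` moments, and
`∑_{m ≥ 1} ν_p(X_m - X_m^{(m)}) < ∞` for
`X_m^{(m)} = f(δ_m, …, δ_1, δ'_0, δ'_{-1}, …)`. -/
structure IsLpmApproximable [MeasurableSpace H] (P : Measure Ω) (p : ℝ≥0∞)
    (δ δ' : ℤ → Ω → S) (f : (ℕ → S) → H) (X : ℕ → Ω → H) : Prop where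
  measurable : Measurable f
  memLp : ∀ n, 1 ≤ n → MemLp (X n) p P
  repr : ∀ n : ℕ, 1 ≤ n → ∀ᵐ ω ∂P, X n ω = f (past δ n ω)
  summable : ∑' i : ℕ,
    eLpNorm (fun ω => X (i + 1) ω - f (coupledPast δ δ' ((i + 1 : ℕ) : ℤ) (i + 1) ω)) p P < ∞

/-- `n⁻¹ ∑_{k=1}^n X_k ⊗ Y_k`. -/
def empCrossMoment (X : ℕ → Ω → H₁) (Y : ℕ → Ω → H₂) (n : ℕ) (ω : Ω) : H₁ →L[ℝ] H₂ :=
  (n : ℝ)⁻¹ • ∑ k ∈ Finset.Icc 1 n, tensor (X k ω) (Y k ω)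

end Probability

end HilbertLM

end

/-! Write `P̂` for the orthogonal projection onto the span of the first `K` empirical eigenvectors.
Then `Ψ̂_K - Ψ = (Δ̂ - ΨĈ) Ĉ⁻¹ P̂ - Ψ (1 - P̂)`. The eigenvalue cutoff gives `‖Ĉ⁻¹ P̂‖ ≤ m_n`, and
`Δ̂ - ΨĈ` is the empirical cross moment of `X` and `ε`. It is of order `n^(-1/2)` because
summable coupling errors make the covariances of `X_k ⊗ ε_k` summable in the Hilbert space tensor
product, so the first term vanishes as soon as `m_n² = o(n)`. For the second, `Ĉ → C` and Weyl's
inequality force `K_n → ∞` and `‖(1 - P̂) C‖ → 0`; as `C` has dense range, `1 - P̂ → 0` strongly,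
and composing with the compact operator `Ψ` turns this into convergence in norm. -/

open scoped InnerProductSpace TensorProduct

namespace HilbertLM

section Spectral

variable {H : Type*} [NormedAddCommGroup H] [InnerProductSpace ℝ H]
  {T T' : H →L[ℝ] H} {lam lam' : ℕ → ℝ} {v v' : ℕ → H} {k : ℕ}

theorem opNorm_le_of_abs_eigenvalue_le [CompleteSpace H] (hc : IsCompactOperator T)
    (hT : T.IsSymmetric) {c : ℝ} (hc0 : 0 ≤ c)
    (h : ∀ μ : ℝ, μ ≠ 0 → ∀ x ≠ 0, T x = μ • x → |μ| ≤ c) : ‖T‖ ≤ c := by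
  have hspec : spectralRadius ℝ T ≤ ENNReal.ofReal c := iSup₂_le fun μ hμ => by
    rw [← enorm_eq_nnnorm, ← ofReal_norm, Real.norm_eq_abs]
    refine ENNReal.ofReal_le_ofReal ?_
    rcases eq_or_ne μ 0 with rfl | hμ0
    · simpa using hc0
    obtain ⟨x, hx⟩ := ((hc.hasEigenvalue_iff_mem_spectrum hμ0).2 hμ).exists_hasEigenvector
    exact h μ hμ0 x hx.2 hx.apply_eq_smul
  rwa [T.spectralRadius_eq_nnnorm hT.isSelfAdjoint, ← enorm_eq_nnnorm, ← ofReal_norm,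
    ENNReal.ofReal_le_ofReal_iff hc0] at hspec

/-- The span of `v 0, …, v (k - 1)`: for an eigensystem, the principal subspace of dimension
`k`. -/
def leadingSpan (v : ℕ → H) (k : ℕ) : Submodule ℝ H := Submodule.span ℝ (v '' Set.Iio k)

instance (v : ℕ → H) (k : ℕ) : FiniteDimensional ℝ (leadingSpan v k) :=
  FiniteDimensional.span_of_finite ℝ ((Set.finite_Iio k).image v)

theorem mem_leadingSpan {j : ℕ} (hj : j < k) : v j ∈ leadingSpan v k :=
  Submodule.subset_span ⟨j, hj, rfl⟩

theorem mem_leadingSpan_orthogonal_iff {x : H} :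
    x ∈ (leadingSpan v k)ᗮ ↔ ∀ j < k, ⟪v j, x⟫_ℝ = 0 := by
  refine ⟨fun hx j hj => hx _ (mem_leadingSpan hj), fun hx => ?_⟩
  have hle : leadingSpan v k ≤ (ℝ ∙ x)ᗮ := by
    rw [leadingSpan, Submodule.span_le]
    rintro _ ⟨j, hj, rfl⟩
    exact Submodule.mem_orthogonal_singleton_iff_inner_left.2 (hx j hj)
  exact fun y hy => Submodule.mem_orthogonal_singleton_iff_inner_left.1 (hle hy)

theorem starProjection_leadingSpan (hv : Orthonormal ℝ v) (x : H) :
    (leadingSpan v k).starProjection x = ∑ j ∈ Finset.range k, ⟪v j, x⟫_ℝ • v j := by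
  refine Submodule.eq_starProjection_of_mem_orthogonal
    (Submodule.sum_mem _ fun j hj => Submodule.smul_mem _ _
      (mem_leadingSpan (Finset.mem_range.1 hj))) ?_
  refine mem_leadingSpan_orthogonal_iff.2 fun j hj => ?_
  rw [inner_sub_right, hv.inner_right_sum _ (Finset.mem_range.2 hj), sub_self]

theorem sum_inner_smul_of_mem_leadingSpan (hv : Orthonormal ℝ v) {x : H}
    (hx : x ∈ leadingSpan v k) : ∑ j ∈ Finset.range k, ⟪v j, x⟫_ℝ • v j = x := by
  rw [← starProjection_leadingSpan hv, Submodule.starProjection_eq_self_iff.2 hx]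

theorem finrank_leadingSpan_le (v : ℕ → H) (k : ℕ) : Module.finrank ℝ (leadingSpan v k) ≤ k := by
  rw [leadingSpan, Set.image_eq_range]
  exact (finrank_range_le_card _).trans (by simp)

theorem finrank_leadingSpan (hv : LinearIndependent ℝ v) (k : ℕ) :
    Module.finrank ℝ (leadingSpan v k) = k := by
  rw [leadingSpan, Set.image_eq_range,
    finrank_span_eq_card (b := fun j : Set.Iio k => v j) (hv.comp _ Subtype.val_injective)]
  simp

theorem tendsto_apply_of_orthonormal [CompleteSpace H] (hT : IsCompactOperator T)
    (hv : Orthonormal ℝ v) : Tendsto (fun j => T (v j)) atTop (𝓝 0) := by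
  have hweak (y : H) : Tendsto (fun j => ⟪T (v j), y⟫_ℝ) atTop (𝓝 0) := by
    have := (hv.inner_products_summable (T.adjoint y)).tendsto_atTop_zero.sqrt
    simpa [Real.sqrt_sq_eq_abs, ContinuousLinearMap.adjoint_inner_right,
      tendsto_zero_iff_abs_tendsto_zero, Function.comp_def] using this
  obtain ⟨K, hK, hTK⟩ := hT.image_closedBall_subset_compact 1
  refine hK.tendsto_nhds_of_unique_mapClusterPt
    (Eventually.of_forall fun j => hTK ⟨v j, by simp [hv.1 j], rfl⟩) fun y _ hy => ?_
  have hclust : MapClusterPt ⟪y, y⟫_ℝ atTop fun j => ⟪T (v j), y⟫_ℝ :=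
    hy.continuousAt_comp (f := fun z => ⟪z, y⟫_ℝ) (by fun_prop)
  exact inner_self_eq_zero.1 (eq_of_nhds_neBot (ClusterPt.mono hclust (hweak y)))

theorem exists_mem_leadingSpan_succ_orthogonal (hv : LinearIndependent ℝ v) (v' : ℕ → H) (k : ℕ) :
    ∃ x ∈ leadingSpan v (k + 1), x ∈ (leadingSpan v' k)ᗮ ∧ x ≠ 0 := by
  have hker : ((leadingSpan v' k).orthogonalProjectionOnto.toLinearMap.domRestrict
      (leadingSpan v (k + 1))).ker ≠ ⊥ := by
    refine LinearMap.ker_ne_bot_of_finrank_lt ?_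
    rw [finrank_leadingSpan hv]
    exact Nat.lt_succ_of_le (finrank_leadingSpan_le v' k)
  obtain ⟨x, hx, hx0⟩ := Submodule.exists_mem_ne_zero_of_ne_bot hker
  exact ⟨x, x.2, Submodule.orthogonalProjectionOnto_eq_zero_iff.1 hx, by simpa using hx0⟩

namespace IsEigenSystem

theorem nonneg (h : IsEigenSystem T lam v) (hT : T.IsPositive) (j : ℕ) : 0 ≤ lam j := by
  simpa [h.eigen, real_inner_smul_left, h.orthonormal.1 j] using hT.inner_nonneg_left (v j)

theorem apply_mem_leadingSpan (h : IsEigenSystem T lam v) {x : H} (hx : x ∈ leadingSpan v k) :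
    T x ∈ leadingSpan v k := by
  rw [← sum_inner_smul_of_mem_leadingSpan h.orthonormal hx, map_sum]
  refine Submodule.sum_mem _ fun j hj => ?_
  rw [map_smul, h.eigen]
  exact Submodule.smul_mem _ _ (Submodule.smul_mem _ _ (mem_leadingSpan (Finset.mem_range.1 hj)))

theorem apply_mem_leadingSpan_orthogonal (h : IsEigenSystem T lam v) (hT : T.IsSymmetric) {x : H}
    (hx : x ∈ (leadingSpan v k)ᗮ) : T x ∈ (leadingSpan v k)ᗮ := fun y hy => by
  rw [← hT.apply_clm, hx _ (h.apply_mem_leadingSpan hy)]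

theorem starProjection_orthogonal_comp (h : IsEigenSystem T lam v) (k : ℕ) :
    (leadingSpan v k)ᗮ.starProjection ∘L T =
      (leadingSpan v k)ᗮ.starProjection ∘L T ∘L (leadingSpan v k)ᗮ.starProjection := by
  set R := (leadingSpan v k)ᗮ.starProjection
  ext x
  have hlead : T (x - R x) ∈ leadingSpan v k := h.apply_mem_leadingSpan <| by
    simp [R]
  have hzero : R (T (x - R x)) = 0 := by
    rwa [Submodule.starProjection_apply_eq_zero_iff, Submodule.orthogonal_orthogonal]
  rwa [map_sub, map_sub, sub_eq_zero] at hzero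

theorem norm_starProjection_orthogonal_comp_le [CompleteSpace H] (h : IsEigenSystem T lam v)
    (hT : T.IsPositive) (hc : IsCompactOperator T) (k : ℕ) :
    ‖(leadingSpan v k)ᗮ.starProjection ∘L T‖ ≤ lam k := by
  set R := (leadingSpan v k)ᗮ.starProjection
  have hpos : (R ∘L T).IsPositive :=
    h.starProjection_orthogonal_comp k ▸ hT.conj_starProjection _
  refine opNorm_le_of_abs_eigenvalue_le (hc.clm_comp R) hpos.isSymmetric (h.nonneg hT k)
    fun μ hμ x hx hRTx => ?_
  have hxmem : x ∈ (leadingSpan v k)ᗮ := by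
    rw [← Submodule.smul_mem_iff _ hμ, ← hRTx]
    exact Submodule.starProjection_apply_mem _ _
  have hTx : T x = μ • x := by
    rw [← hRTx]
    exact (Submodule.starProjection_eq_self_iff.2
      (h.apply_mem_leadingSpan_orthogonal hT.isSymmetric hxmem)).symm
  have hμ0 : 0 ≤ μ := by
    have := hT.inner_nonneg_left x
    rw [hTx, real_inner_smul_left, real_inner_self_eq_norm_sq] at this
    exact nonneg_of_mul_nonneg_left this (by positivity)
  rw [abs_of_nonneg hμ0]
  by_contra! hlt
  have hlead : x ∈ leadingSpan v k := by
    refine Submodule.span_mono (Set.image_mono fun j hj => ?_) (h.complete μ hμ x hTx)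
    by_contra! hkj
    exact absurd (h.antitone (not_lt.1 hkj)) (not_le.2 (hlt.trans_eq hj.symm))
  exact hx (inner_self_eq_zero.1 (hxmem x hlead))

theorem inner_le_of_mem_orthogonal [CompleteSpace H] (h : IsEigenSystem T lam v)
    (hT : T.IsPositive) (hc : IsCompactOperator T) {x : H} (hx : x ∈ (leadingSpan v k)ᗮ) :
    ⟪T x, x⟫_ℝ ≤ lam k * ‖x‖ ^ 2 := by
  have hTx : ‖T x‖ ≤ lam k * ‖x‖ := by
    have := ContinuousLinearMap.le_of_opNorm_le _
      (h.norm_starProjection_orthogonal_comp_le hT hc k) x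
    rwa [ContinuousLinearMap.comp_apply, Submodule.starProjection_eq_self_iff.2
      (h.apply_mem_leadingSpan_orthogonal hT.isSymmetric hx)] at this
  calc ⟪T x, x⟫_ℝ ≤ ‖T x‖ * ‖x‖ := real_inner_le_norm _ _
    _ ≤ lam k * ‖x‖ * ‖x‖ := by gcongr
    _ = lam k * ‖x‖ ^ 2 := by ring

theorem le_inner_of_mem_leadingSpan_succ (h : IsEigenSystem T lam v) {x : H}
    (hx : x ∈ leadingSpan v (k + 1)) : lam k * ‖x‖ ^ 2 ≤ ⟪T x, x⟫_ℝ := by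
  have hsum := sum_inner_smul_of_mem_leadingSpan h.orthonormal hx
  have hnorm : ‖x‖ ^ 2 = ∑ j ∈ Finset.range (k + 1), ⟪v j, x⟫_ℝ ^ 2 := by
    rw [← real_inner_self_eq_norm_sq]
    nth_rw 1 [← hsum]
    simp [sum_inner, real_inner_smul_left, sq]
  have hinner : ⟪T x, x⟫_ℝ = ∑ j ∈ Finset.range (k + 1), lam j * ⟪v j, x⟫_ℝ ^ 2 := by
    nth_rw 1 [← hsum]
    rw [map_sum, sum_inner]
    refine Finset.sum_congr rfl fun j _ => ?_
    rw [map_smul, h.eigen, real_inner_smul_left, real_inner_smul_left]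
    ring
  rw [hnorm, hinner, Finset.mul_sum]
  gcongr with j hj
  exact h.antitone (Finset.mem_range_succ_iff.1 hj)

/-- Weyl's inequality. -/
theorem le_add_norm_sub [CompleteSpace H] (h : IsEigenSystem T lam v)
    (h' : IsEigenSystem T' lam' v') (hT' : T'.IsPositive) (hc' : IsCompactOperator T') (k : ℕ) :
    lam k ≤ lam' k + ‖T - T'‖ := by
  obtain ⟨x, hx, hx', hx0⟩ :=
    exists_mem_leadingSpan_succ_orthogonal h.orthonormal.linearIndependent v' k
  have hsub : ⟪(T - T') x, x⟫_ℝ ≤ ‖T - T'‖ * ‖x‖ ^ 2 :=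
    calc ⟪(T - T') x, x⟫_ℝ ≤ ‖(T - T') x‖ * ‖x‖ := real_inner_le_norm _ _
      _ ≤ ‖T - T'‖ * ‖x‖ * ‖x‖ := by gcongr; exact (T - T').le_opNorm x
      _ = ‖T - T'‖ * ‖x‖ ^ 2 := by ring
  refine le_of_mul_le_mul_right ?_ (show 0 < ‖x‖ ^ 2 by positivity)
  calc lam k * ‖x‖ ^ 2 ≤ ⟪T x, x⟫_ℝ := h.le_inner_of_mem_leadingSpan_succ hx
    _ = ⟪T' x, x⟫_ℝ + ⟪(T - T') x, x⟫_ℝ := by rw [← inner_add_left]; simp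
    _ ≤ lam' k * ‖x‖ ^ 2 + ‖T - T'‖ * ‖x‖ ^ 2 :=
      add_le_add (h'.inner_le_of_mem_orthogonal hT' hc' hx') hsub
    _ = (lam' k + ‖T - T'‖) * ‖x‖ ^ 2 := by ring

theorem abs_sub_le_norm_sub [CompleteSpace H] (h : IsEigenSystem T lam v) (hT : T.IsPositive)
    (hc : IsCompactOperator T) (h' : IsEigenSystem T' lam' v') (hT' : T'.IsPositive)
    (hc' : IsCompactOperator T') (k : ℕ) : |lam k - lam' k| ≤ ‖T - T'‖ := by
  have h₁ := h.le_add_norm_sub h' hT' hc' k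
  have h₂ := h'.le_add_norm_sub h hT hc k
  rw [norm_sub_rev] at h₂
  exact abs_sub_le_iff.2 ⟨by linarith, by linarith⟩

theorem tendsto_zero [CompleteSpace H] (h : IsEigenSystem T lam v) (hc : IsCompactOperator T) :
    Tendsto lam atTop (𝓝 0) := by
  have := (tendsto_apply_of_orthonormal hc h.orthonormal).norm
  simpa [h.eigen, norm_smul, h.orthonormal.1, ← tendsto_zero_iff_norm_tendsto_zero,
    tendsto_zero_iff_abs_tendsto_zero, Function.comp_def] using this

end IsEigenSystem

end Spectral

section Truncation

variable {lam : ℕ → ℝ} {m : ℝ}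

theorem gap_le (h0 : ∀ j, 0 ≤ lam j) (j : ℕ) : gap lam j ≤ lam j := by
  cases j with
  | zero => simpa [gap] using h0 1
  | succ j => exact (min_le_right _ _).trans (by simpa using h0 (j + 2))

theorem gap_pos (ha : StrictAnti lam) (j : ℕ) : 0 < gap lam j := by
  cases j with
  | zero => exact sub_pos.2 (ha one_pos)
  | succ j => exact lt_min (sub_pos.2 (ha j.lt_succ_self)) (sub_pos.2 (ha (j + 1).lt_succ_self))

theorem continuous_gap (j : ℕ) : Continuous fun lam : ℕ → ℝ => gap lam j := by
  cases j <;> (simp only [gap]; fun_prop)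

theorem bddAbove_truncB (hl : Tendsto lam atTop (𝓝 0)) (hm : 0 < m) :
    BddAbove {j : ℕ | 1 ≤ j ∧ 0 < lam (j - 1) ∧ (lam (j - 1))⁻¹ ≤ m} := by
  obtain ⟨N, hN⟩ := (hl.eventually (gt_mem_nhds (inv_pos.2 hm))).exists_forall_of_atTop
  refine ⟨N, fun j ⟨_, hpos, hinv⟩ => ?_⟩
  by_contra! hj
  exact absurd (inv_le_of_inv_le₀ hpos hinv) (not_le.2 (hN (j - 1) (by lia)))

theorem bddAbove_truncE (h0 : ∀ j, 0 ≤ lam j) (hl : Tendsto lam atTop (𝓝 0)) (hm : 0 < m) :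
    BddAbove {k : ℕ | 1 ≤ k ∧ ∀ j < k, 0 < gap lam j ∧ (gap lam j)⁻¹ ≤ m} := by
  refine (bddAbove_truncB hl hm).mono fun k ⟨hk, hgap⟩ => ?_
  obtain ⟨hpos, hinv⟩ := hgap (k - 1) (by lia)
  have hle := gap_le h0 (k - 1)
  exact ⟨hk, hpos.trans_le hle, (inv_anti₀ hpos hle).trans hinv⟩

theorem inv_le_of_lt_truncK (ha : Antitone lam) (hl : Tendsto lam atTop (𝓝 0)) (hm : 0 < m)
    {j : ℕ} (hj : j < truncK lam m) : 0 < lam j ∧ (lam j)⁻¹ ≤ m := by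
  have hB : j < truncB lam m := hj.trans_le ((min_le_left _ _).trans (min_le_left _ _))
  have hne : {j : ℕ | 1 ≤ j ∧ 0 < lam (j - 1) ∧ (lam (j - 1))⁻¹ ≤ m}.Nonempty := by
    by_contra hne
    rw [truncB, Set.not_nonempty_iff_eq_empty.1 hne] at hB
    simp at hB
  obtain ⟨-, hpos, hinv⟩ := Nat.sSup_mem hne (bddAbove_truncB hl hm)
  have hle : lam (truncB lam m - 1) ≤ lam j := ha (by lia)
  exact ⟨hpos.trans_le hle, (inv_anti₀ hpos hle).trans hinv⟩

theorem le_truncK (h0 : ∀ j, 0 ≤ lam j) (hl : Tendsto lam atTop (𝓝 0)) (hm : 0 < m)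
    {k : ℕ} (hk : 1 ≤ k) (hkm : k ≤ m) (hgap : ∀ j < k, m⁻¹ ≤ gap lam j) : k ≤ truncK lam m := by
  have hm' : 0 < m⁻¹ := inv_pos.2 hm
  have hlam : m⁻¹ ≤ lam (k - 1) := (hgap (k - 1) (by lia)).trans (gap_le h0 _)
  refine le_min (le_min ?_ ?_) (Nat.le_floor hkm)
  · exact le_csSup (bddAbove_truncB hl hm)
      ⟨hk, hm'.trans_le hlam, inv_le_of_inv_le₀ hm hlam⟩
  · exact le_csSup (bddAbove_truncE h0 hl hm)
      ⟨hk, fun j hj => ⟨hm'.trans_le (hgap j hj), inv_le_of_inv_le₀ hm (hgap j hj)⟩⟩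

variable {ι : Type*} {l : Filter ι} {lamHat : ι → ℕ → ℝ} {mHat : ι → ℝ}

theorem tendsto_truncK (h0 : ∀ᶠ i in l, ∀ j, 0 ≤ lamHat i j)
    (hl : ∀ᶠ i in l, Tendsto (lamHat i) atTop (𝓝 0)) (hlim : Tendsto lamHat l (𝓝 lam))
    (hlam : StrictAnti lam) (hm : Tendsto mHat l atTop) :
    Tendsto (fun i => truncK (lamHat i) (mHat i)) l atTop := by
  refine tendsto_atTop.2 fun k => ?_
  have hgap : ∀ᶠ i in l, ∀ j < k + 1, (mHat i)⁻¹ < gap (lamHat i) j :=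
    (eventually_all_finite (Set.finite_Iio (k + 1))).2 fun j _ =>
      hm.inv_tendsto_atTop.eventually_lt (((continuous_gap j).tendsto lam).comp hlim)
        (gap_pos hlam j)
  filter_upwards [h0, hl, hgap, hm.eventually_ge_atTop ((k + 1 : ℕ) : ℝ)] with i hi0 hil higap him
  exact k.le_succ.trans (le_truncK hi0 hil ((Nat.cast_pos.2 k.succ_pos).trans_le him)
    k.succ_pos him fun j hj => (higap j hj).le)

theorem tendsto_apply_zero_of_antitone {a : ι → ℕ → ℝ} {b : ℕ → ℝ} {K : ι → ℕ}
    (ha : ∀ᶠ i in l, Antitone (a i)) (h0 : ∀ᶠ i in l, ∀ j, 0 ≤ a i j)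
    (hlim : Tendsto a l (𝓝 b)) (hb : Tendsto b atTop (𝓝 0)) (hK : Tendsto K l atTop) :
    Tendsto (fun i => a i (K i)) l (𝓝 0) := by
  refine Metric.tendsto_nhds.2 fun η hη => ?_
  obtain ⟨k, hk⟩ := (hb.eventually (gt_mem_nhds hη)).exists
  filter_upwards [ha, h0, (tendsto_pi_nhds.1 hlim k).eventually (gt_mem_nhds hk),
    hK.eventually_ge_atTop k] with i hanti hnonneg hlt hle
  rw [Real.dist_0_eq_abs, abs_of_nonneg (hnonneg _)]
  exact (hanti hle).trans_lt hlt

end Truncation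

section CompactOperators

variable {E F G H ι : Type*} [NormedAddCommGroup E] [NormedSpace ℝ E] [NormedAddCommGroup F]
  [NormedSpace ℝ F] [NormedAddCommGroup G] [NormedSpace ℝ G] [NormedAddCommGroup H]
  [InnerProductSpace ℝ H] {l : Filter ι}

theorem equicontinuous_of_norm_le {R : ι → F →L[ℝ] G} {c : ℝ} (hR : ∀ i, ‖R i‖ ≤ c) :
    Equicontinuous fun i x => R i x :=
  ((NormedSpace.equicontinuous_TFAE R).out 5 1 : (∃ c, ∀ i, ‖R i‖ ≤ c) ↔ _).1 ⟨c, hR⟩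

theorem tendsto_apply_zero_of_denseRange {R : ι → F →L[ℝ] G} {c : ℝ} (hR : ∀ i, ‖R i‖ ≤ c)
    {A : E →L[ℝ] F} (hA : DenseRange A) (h : Tendsto (fun i => R i ∘L A) l (𝓝 0)) (x : F) :
    Tendsto (fun i => R i x) l (𝓝 0) := by
  refine hA.induction_on x
    ((equicontinuous_of_norm_le hR).isClosed_setOfPred_tendsto continuous_const) fun y => ?_
  exact ((ContinuousLinearMap.apply ℝ G y).continuous.tendsto' 0 0 (map_zero _)).comp h

theorem tendsto_comp_zero_of_isCompactOperator {R : ι → F →L[ℝ] G} {c : ℝ} (hR : ∀ i, ‖R i‖ ≤ c)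
    (h : ∀ x, Tendsto (fun i => R i x) l (𝓝 0)) {A : E →L[ℝ] F} (hA : IsCompactOperator A) :
    Tendsto (fun i => R i ∘L A) l (𝓝 0) := by
  obtain ⟨K, hK, hAK⟩ := hA.image_closedBall_subset_compact 1
  have hunif : TendstoUniformlyOn (fun i x => R i x) 0 l K := by
    have := (EquicontinuousOn.tendsto_uniformOnFun_iff_pi' (𝔖 := {K}) (by simpa using hK)
      (fun s _ => (equicontinuous_of_norm_le hR).equicontinuousOn s) l 0).2
      (tendsto_pi_nhds.2 fun x => h x)
    exact UniformOnFun.tendsto_iff_tendstoUniformlyOn.1 this K rfl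
  refine Metric.tendsto_nhds.2 fun η hη => ?_
  filter_upwards [Metric.tendstoUniformlyOn_iff.1 hunif (η / 2) (half_pos hη)] with i hi
  rw [dist_zero_right]
  refine (ContinuousLinearMap.opNorm_le_of_unit_norm (half_pos hη).le fun x hx => ?_).trans_lt
    (half_lt_self hη)
  simpa using (hi (A x) (hAK ⟨x, by simp [hx], rfl⟩)).le

theorem tendsto_comp_zero_of_isSelfAdjoint [CompleteSpace H] {H' : Type*} [NormedAddCommGroup H']
    [InnerProductSpace ℝ H'] [CompleteSpace H'] {R : ι → H →L[ℝ] H} {c : ℝ}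
    (hR : ∀ i, ‖R i‖ ≤ c) (hself : ∀ i, IsSelfAdjoint (R i))
    (h : ∀ x, Tendsto (fun i => R i x) l (𝓝 0)) {A : H →L[ℝ] H'} (hA : IsCompactOperator A) :
    Tendsto (fun i => A ∘L R i) l (𝓝 0) := by
  have hsq (i : ι) : ‖A ∘L R i‖ ^ 2 ≤ ‖R i ∘L A.adjoint ∘L A‖ * c :=
    calc ‖A ∘L R i‖ ^ 2 = ‖(A ∘L R i).adjoint ∘L A ∘L R i‖ := by
          rw [sq, ContinuousLinearMap.norm_adjoint_comp_self]
      _ = ‖(R i ∘L A.adjoint ∘L A) ∘L R i‖ := by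
          rw [ContinuousLinearMap.adjoint_comp, (hself i).adjoint_eq]; rfl
      _ ≤ ‖R i ∘L A.adjoint ∘L A‖ * ‖R i‖ := ContinuousLinearMap.opNorm_comp_le _ _
      _ ≤ ‖R i ∘L A.adjoint ∘L A‖ * c := by gcongr; exact hR i
  have hlim := (tendsto_comp_zero_of_isCompactOperator hR h (A := A.adjoint ∘L A)
    (hA.clm_comp A.adjoint)).norm.mul_const c
  rw [norm_zero, zero_mul] at hlim
  have := (squeeze_zero (fun i => sq_nonneg ‖A ∘L R i‖) hsq hlim).sqrt
  rw [tendsto_zero_iff_norm_tendsto_zero]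
  simpa using this

end CompactOperators

section PrincipalComponents

variable {H H₁ H₂ : Type*} [NormedAddCommGroup H] [InnerProductSpace ℝ H] [NormedAddCommGroup H₁]
  [InnerProductSpace ℝ H₁] [NormedAddCommGroup H₂] [InnerProductSpace ℝ H₂]

@[simp]
theorem tensor_apply (x w : H₁) (y : H₂) : tensor x y w = ⟪x, w⟫_ℝ • y := rfl

@[simp]
theorem norm_tensor (x : H₁) (y : H₂) : ‖tensor x y‖ = ‖x‖ * ‖y‖ := by
  rw [tensor, InnerProductSpace.norm_rankOne, mul_comm]

variable {T : H →L[ℝ] H} {lam : ℕ → ℝ} {v : ℕ → H} {K : ℕ} {c : ℝ}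

theorem pcaOperator_eq_comp (D : H →L[ℝ] H₂) (lam : ℕ → ℝ) (v : ℕ → H) (K : ℕ) :
    pcaOperator D lam v K = D ∘L pcaOperator (.id ℝ H) lam v K := by
  ext x
  simp [pcaOperator]

theorem IsEigenSystem.comp_pcaOperator_id (h : IsEigenSystem T lam v)
    (hlam : ∀ j < K, lam j ≠ 0) :
    T ∘L pcaOperator (.id ℝ H) lam v K = (leadingSpan v K).starProjection := by
  ext x
  rw [starProjection_leadingSpan h.orthonormal]
  simp only [pcaOperator, ContinuousLinearMap.comp_apply, _root_.sum_apply, tensor_apply,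
    ContinuousLinearMap.id_apply, map_sum, map_smul, h.eigen]
  refine Finset.sum_congr rfl fun j hj => ?_
  rw [inv_smul_smul₀ (hlam j (Finset.mem_range.1 hj))]

theorem norm_pcaOperator_id_le (hv : Orthonormal ℝ v) (hc : 0 ≤ c)
    (hlam : ∀ j < K, |(lam j)⁻¹| ≤ c) : ‖pcaOperator (.id ℝ H) lam v K‖ ≤ c := by
  refine ContinuousLinearMap.opNorm_le_bound _ hc fun x => ?_
  have hx : pcaOperator (.id ℝ H) lam v K x =
      ∑ j ∈ Finset.range K, (⟪v j, x⟫_ℝ * (lam j)⁻¹) • v j := by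
    simp [pcaOperator, smul_smul]
  refine (sq_le_sq₀ (norm_nonneg _) (by positivity)).1 ?_
  calc ‖pcaOperator (.id ℝ H) lam v K x‖ ^ 2
      = ∑ j ∈ Finset.range K, (⟪v j, x⟫_ℝ * (lam j)⁻¹) ^ 2 := by
        rw [hx, ← real_inner_self_eq_norm_sq, hv.inner_sum]
        simp [sq]
    _ ≤ ∑ j ∈ Finset.range K, c ^ 2 * ‖⟪v j, x⟫_ℝ‖ ^ 2 := by
        refine Finset.sum_le_sum fun j hj => ?_
        rw [mul_pow, mul_comm, Real.norm_eq_abs, sq_abs]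
        gcongr ?_ * _
        exact sq_le_sq.2 ((hlam j (Finset.mem_range.1 hj)).trans (le_abs_self c))
    _ ≤ c ^ 2 * ‖x‖ ^ 2 := by
        rw [← Finset.mul_sum]
        gcongr
        exact hv.sum_inner_products_le x
    _ = (c * ‖x‖) ^ 2 := (mul_pow _ _ _).symm

theorem IsEigenSystem.norm_pcaOperator_sub_le (h : IsEigenSystem T lam v) (D Ψ : H →L[ℝ] H₂)
    (hc : 0 ≤ c) (hlam : ∀ j < K, 0 < lam j ∧ (lam j)⁻¹ ≤ c) :
    ‖pcaOperator D lam v K - Ψ‖ ≤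
      ‖Ψ ∘L (leadingSpan v K)ᗮ.starProjection‖ + c * ‖D - Ψ ∘L T‖ := by
  set G := pcaOperator (.id ℝ H) lam v K
  have hG : ‖G‖ ≤ c := norm_pcaOperator_id_le h.orthonormal hc fun j hj => by
    rw [abs_of_pos (inv_pos.2 (hlam j hj).1)]
    exact (hlam j hj).2
  have hdecomp : pcaOperator D lam v K - Ψ =
      (D - Ψ ∘L T) ∘L G - Ψ ∘L (leadingSpan v K)ᗮ.starProjection := by
    ext x
    have hTG := DFunLike.congr_fun (h.comp_pcaOperator_id fun j hj => (hlam j hj).1.ne') x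
    rw [ContinuousLinearMap.comp_apply] at hTG
    rw [pcaOperator_eq_comp]
    simp [G, hTG]
  calc ‖pcaOperator D lam v K - Ψ‖
      ≤ ‖(D - Ψ ∘L T) ∘L G‖ + ‖Ψ ∘L (leadingSpan v K)ᗮ.starProjection‖ :=
        hdecomp ▸ norm_sub_le _ _
    _ ≤ ‖D - Ψ ∘L T‖ * c + ‖Ψ ∘L (leadingSpan v K)ᗮ.starProjection‖ := by
        gcongr
        exact (ContinuousLinearMap.opNorm_comp_le _ _).trans (by gcongr)
    _ = _ := by ring

end PrincipalComponents

section Consistency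

variable {H H₂ ι : Type*} [NormedAddCommGroup H] [InnerProductSpace ℝ H] [CompleteSpace H]
  [NormedAddCommGroup H₂] [InnerProductSpace ℝ H₂] [CompleteSpace H₂] {l : Filter ι}
  {C : H →L[ℝ] H} {lam : ℕ → ℝ} {v : ℕ → H} {T : ι → H →L[ℝ] H} {lamHat : ι → ℕ → ℝ}
  {vHat : ι → ℕ → H} {K : ι → ℕ} {m : ι → ℝ}

theorem IsEigenSystem.tendsto_eigenvalues (hC : IsEigenSystem C lam v) (hCpos : C.IsPositive)
    (hCc : IsCompactOperator C) (hT : ∀ᶠ i in l, IsEigenSystem (T i) (lamHat i) (vHat i))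
    (hTpos : ∀ i, (T i).IsPositive) (hTc : ∀ i, IsCompactOperator (T i))
    (hlim : Tendsto T l (𝓝 C)) : Tendsto lamHat l (𝓝 lam) := by
  refine tendsto_pi_nhds.2 fun j => tendsto_iff_norm_sub_tendsto_zero.2 ?_
  refine squeeze_zero' (.of_forall fun i => norm_nonneg _) ?_
    (tendsto_iff_norm_sub_tendsto_zero.1 hlim)
  filter_upwards [hT] with i hi
  exact hi.abs_sub_le_norm_sub (hTpos i) (hTc i) hC hCpos hCc j

theorem tendsto_starProjection_orthogonal_comp
    (hT : ∀ᶠ i in l, IsEigenSystem (T i) (lamHat i) (vHat i))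
    (hTpos : ∀ i, (T i).IsPositive) (hTc : ∀ i, IsCompactOperator (T i))
    (hlim : Tendsto T l (𝓝 C)) (hK : Tendsto (fun i => lamHat i (K i)) l (𝓝 0)) :
    Tendsto (fun i => (leadingSpan (vHat i) (K i))ᗮ.starProjection ∘L C) l (𝓝 0) := by
  have hdiff : Tendsto (fun i => ‖C - T i‖) l (𝓝 0) := by
    simpa using (hlim.const_sub C).norm
  refine squeeze_zero_norm' ?_ (by simpa using hK.add hdiff)
  filter_upwards [hT] with i hi
  set R := (leadingSpan (vHat i) (K i))ᗮ.starProjection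
  calc ‖R ∘L C‖ = ‖R ∘L T i + R ∘L (C - T i)‖ := by
        rw [← ContinuousLinearMap.comp_add, add_sub_cancel]
    _ ≤ ‖R ∘L T i‖ + ‖R‖ * ‖C - T i‖ :=
        (norm_add_le _ _).trans (by gcongr; exact ContinuousLinearMap.opNorm_comp_le _ _)
    _ ≤ lamHat i (K i) + 1 * ‖C - T i‖ := by
        gcongr
        · exact hi.norm_starProjection_orthogonal_comp_le (hTpos i) (hTc i) _
        · exact Submodule.starProjection_norm_le _
    _ = lamHat i (K i) + ‖C - T i‖ := by rw [one_mul]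

theorem tendsto_comp_starProjection_orthogonal
    (hT : ∀ᶠ i in l, IsEigenSystem (T i) (lamHat i) (vHat i))
    (hTpos : ∀ i, (T i).IsPositive) (hTc : ∀ i, IsCompactOperator (T i))
    (hlim : Tendsto T l (𝓝 C)) (hrange : DenseRange C)
    (hK : Tendsto (fun i => lamHat i (K i)) l (𝓝 0)) {Ψ : H →L[ℝ] H₂}
    (hΨ : IsCompactOperator Ψ) :
    Tendsto (fun i => Ψ ∘L (leadingSpan (vHat i) (K i))ᗮ.starProjection) l (𝓝 0) := by
  have hnorm (i : ι) := Submodule.starProjection_norm_le (leadingSpan (vHat i) (K i))ᗮ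
  refine tendsto_comp_zero_of_isSelfAdjoint hnorm (fun i => isSelfAdjoint_starProjection _) ?_ hΨ
  exact tendsto_apply_zero_of_denseRange hnorm hrange
    (tendsto_starProjection_orthogonal_comp hT hTpos hTc hlim hK)

theorem tendsto_pcaOperator_truncK (hC : IsEigenSystem C lam v) (hCpos : C.IsPositive)
    (hCc : IsCompactOperator C) (hinj : Function.Injective lam) (hrange : DenseRange C)
    (hT : ∀ᶠ i in l, IsEigenSystem (T i) (lamHat i) (vHat i))
    (hTpos : ∀ i, (T i).IsPositive) (hTc : ∀ i, IsCompactOperator (T i))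
    (hlim : Tendsto T l (𝓝 C)) (hm : Tendsto m l atTop) {Ψ : H →L[ℝ] H₂}
    (hΨ : IsCompactOperator Ψ) {D : ι → H →L[ℝ] H₂}
    (hD : Tendsto (fun i => m i • (D i - Ψ ∘L T i)) l (𝓝 0)) :
    Tendsto (fun i => pcaOperator (D i) (lamHat i) (vHat i) (truncK (lamHat i) (m i))) l
      (𝓝 Ψ) := by
  have hlam := hC.tendsto_eigenvalues hCpos hCc hT hTpos hTc hlim
  have hnonneg : ∀ᶠ i in l, ∀ j, 0 ≤ lamHat i j := hT.mono fun i hi => hi.nonneg (hTpos i)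
  have hzero : ∀ᶠ i in l, Tendsto (lamHat i) atTop (𝓝 0) :=
    hT.mono fun i hi => hi.tendsto_zero (hTc i)
  have hK := tendsto_truncK hnonneg hzero hlam (hC.antitone.strictAnti_of_injective hinj) hm
  have hlamK := tendsto_apply_zero_of_antitone (hT.mono fun i hi => hi.antitone) hnonneg hlam
    (hC.tendsto_zero hCc) hK
  have hΨR := tendsto_comp_starProjection_orthogonal hT hTpos hTc hlim hrange hlamK hΨ
  refine tendsto_iff_norm_sub_tendsto_zero.2 (squeeze_zero' (.of_forall fun i => norm_nonneg _) ?_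
    (by simpa using hΨR.norm.add hD.norm))
  filter_upwards [hT, hzero, hm.eventually_gt_atTop 0] with i hi hi0 hmi
  rw [norm_smul, Real.norm_of_nonneg hmi.le]
  exact hi.norm_pcaOperator_sub_le _ _ hmi.le fun j => inv_le_of_lt_truncK hi.antitone hi0 hmi

end Consistency

section HilbertSchmidt

variable {H₁ H₂ ι : Type*} [NormedAddCommGroup H₁] [InnerProductSpace ℝ H₁]
  [NormedAddCommGroup H₂] [InnerProductSpace ℝ H₂] {e : ι → H₁}

theorem isCompactOperator_tensor (x : H₁) (y : H₂) : IsCompactOperator (tensor x y) :=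
  (isCompactOperator_of_locallyCompactSpace_dom (innerSL ℝ x)).clm_comp
    (ContinuousLinearMap.toSpanSingleton ℝ y)

theorem norm_sum_tensor_le_of_orthonormal (he : Orthonormal ℝ e) (y : ι → H₂) (F : Finset ι) :
    ‖∑ i ∈ F, tensor (e i) (y i)‖ ≤ √(∑ i ∈ F, ‖y i‖ ^ 2) := by
  refine ContinuousLinearMap.opNorm_le_bound _ (Real.sqrt_nonneg _) fun x => ?_
  calc ‖(∑ i ∈ F, tensor (e i) (y i)) x‖
      ≤ ∑ i ∈ F, ‖y i‖ * ‖⟪e i, x⟫_ℝ‖ := by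
        simp only [_root_.sum_apply, tensor_apply]
        exact norm_sum_le_of_le _ fun i _ => (norm_smul_le _ _).trans_eq (mul_comm _ _)
    _ ≤ √(∑ i ∈ F, ‖y i‖ ^ 2) * √(∑ i ∈ F, ‖⟪e i, x⟫_ℝ‖ ^ 2) :=
        Real.sum_mul_le_sqrt_mul_sqrt _ _ _
    _ ≤ √(∑ i ∈ F, ‖y i‖ ^ 2) * ‖x‖ := by
        gcongr
        exact Real.sqrt_le_iff.2 ⟨norm_nonneg _, he.sum_inner_products_le x⟩

variable [CompleteSpace H₂]

theorem summable_tensor_of_orthonormal (he : Orthonormal ℝ e) {y : ι → H₂}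
    (hy : Summable fun i => ‖y i‖ ^ 2) : Summable fun i => tensor (e i) (y i) := by
  refine summable_iff_vanishing_norm.2 fun η hη => ?_
  obtain ⟨s, hs⟩ := summable_iff_vanishing_norm.1 hy (η ^ 2) (by positivity)
  refine ⟨s, fun t ht => (norm_sum_tensor_le_of_orthonormal he y t).trans_lt ?_⟩
  exact (Real.sqrt_lt' hη).2 ((le_abs_self _).trans_lt (hs t ht))

variable [CompleteSpace H₁]

theorem IsHilbertSchmidt.isCompactOperator {Ψ : H₁ →L[ℝ] H₂} (hΨ : IsHilbertSchmidt Ψ) :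
    IsCompactOperator Ψ := by
  obtain ⟨s, b, -⟩ := exists_hilbertBasis ℝ H₁
  obtain ⟨T, hT⟩ := summable_tensor_of_orthonormal b.orthonormal (hΨ s b)
  have hTΨ : T = Ψ := by
    ext x
    refine (hT.mapL (ContinuousLinearMap.apply ℝ H₂ x)).unique ?_
    simpa [b.repr_apply_apply] using (b.hasSum_repr x).mapL Ψ
  rw [hTΨ] at hT
  exact isCompactOperator_of_tendsto hT <| .of_forall fun F =>
    (compactOperator (RingHom.id ℝ) H₁ H₂).sum_mem fun i _ => isCompactOperator_tensor _ _

end HilbertSchmidt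

section InProbability

variable {Ω ι E : Type*} [MeasurableSpace Ω] {P : Measure Ω} {l : Filter ι}

/-- The filter of sets of pairs `(i, ω)` whose sections have asymptotically full measure as `i`
tends to `l`. Convergence along it is convergence in probability, to which all the rules for
limits along filters thereby apply. -/
def inProbability (P : Measure Ω) (l : Filter ι) : Filter (ι × Ω) where
  sets := {s | Tendsto (fun i => P {ω | (i, ω) ∉ s}) l (𝓝 0)}
  univ_sets := by simpa using tendsto_const_nhds
  sets_of_superset {s t} hs hst :=
    tendsto_of_tendsto_of_tendsto_of_le_of_le tendsto_const_nhds hs (fun _ => zero_le)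
      fun i => measure_mono fun ω hω hωs => hω (hst hωs)
  inter_sets {s t} hs ht := by
    refine tendsto_of_tendsto_of_tendsto_of_le_of_le tendsto_const_nhds
      (by simpa using Tendsto.add hs ht) (fun _ => zero_le) fun i => ?_
    refine (measure_mono fun ω hω => ?_).trans (measure_union_le _ _)
    exact not_and_or.1 hω

theorem eventually_inProbability {p : ι × Ω → Prop} :
    (∀ᶠ q in inProbability P l, p q) ↔ Tendsto (fun i => P {ω | ¬ p (i, ω)}) l (𝓝 0) :=
  Iff.rfl

theorem eventually_inProbability_of_ae {p : ι × Ω → Prop}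
    (h : ∀ᶠ i in l, ∀ᵐ ω ∂P, p (i, ω)) : ∀ᶠ q in inProbability P l, p q :=
  eventually_inProbability.2 <| tendsto_const_nhds.congr' <| h.mono fun _ hi => hi.symm

theorem tendsto_fst_inProbability : Tendsto Prod.fst (inProbability P l) l :=
  fun _ hs => eventually_inProbability_of_ae <| mem_of_superset hs fun _ hi =>
    ae_of_all _ fun _ => hi

theorem tendsto_inProbability_iff [PseudoEMetricSpace E] {f : ι → Ω → E} {c : E} :
    Tendsto (fun q => f q.1 q.2) (inProbability P l) (𝓝 c) ↔
      TendstoInMeasure P f l fun _ => c := by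
  simp only [Metric.nhds_basis_eball.tendsto_right_iff, eventually_inProbability,
    Metric.mem_eball, not_lt, TendstoInMeasure]

end InProbability

section WeakDependence

variable {E : Type*} [NormedAddCommGroup E] [InnerProductSpace ℝ E] {a : ℕ → ℝ} {z : ℕ → E}

theorem sum_apply_dist_le (ha : ∀ m, 0 ≤ a m) (hs : Summable a) (k : ℕ) (s : Finset ℕ) :
    ∑ j ∈ s, a (Nat.dist k j) ≤ 2 * ∑' m, a m := by
  rw [← Finset.sum_filter_add_sum_filter_not s (k ≤ ·), two_mul]
  gcongr
  all_goals
    rw [← Finset.sum_image (f := a) (g := Nat.dist k)]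
    · exact hs.sum_le_tsum _ fun i _ => ha i
    · intro i hi j hj hij
      simp only [Finset.coe_filter, Set.mem_ofPred_eq, Nat.dist] at hi hj hij
      omega

theorem norm_sum_sq_le_of_inner_le (ha : ∀ m, 0 ≤ a m) (hs : Summable a)
    (h : ∀ k m, ⟪z k, z (k + m)⟫_ℝ ≤ a m) (s : Finset ℕ) :
    ‖∑ k ∈ s, z k‖ ^ 2 ≤ s.card * (2 * ∑' m, a m) := by
  have hdist (k j : ℕ) : ⟪z k, z j⟫_ℝ ≤ a (Nat.dist k j) := by
    wlog hkj : k ≤ j generalizing k j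
    · rw [real_inner_comm, Nat.dist_comm]
      exact this j k (le_of_not_ge hkj)
    obtain ⟨m, rfl⟩ := Nat.exists_eq_add_of_le hkj
    simpa [Nat.dist] using h k m
  calc ‖∑ k ∈ s, z k‖ ^ 2 = ∑ k ∈ s, ∑ j ∈ s, ⟪z k, z j⟫_ℝ := by
        simp only [← real_inner_self_eq_norm_sq, sum_inner, inner_sum]
        exact Finset.sum_comm
    _ ≤ ∑ _k ∈ s, 2 * ∑' m, a m := Finset.sum_le_sum fun k _ =>
        (Finset.sum_le_sum fun j _ => hdist k j).trans (sum_apply_dist_le ha hs k s)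
    _ = s.card * (2 * ∑' m, a m) := by rw [Finset.sum_const, nsmul_eq_mul]

theorem tendsto_smul_sum_zero_of_inner_le (ha : ∀ m, 0 ≤ a m) (hs : Summable a)
    (h : ∀ k m, ⟪z k, z (k + m)⟫_ℝ ≤ a m) {b : ℕ → ℝ}
    (hb : (fun n => b n ^ 2) =o[atTop] fun n => (n : ℝ)) :
    Tendsto (fun n : ℕ => (b n / n) • ∑ k ∈ Finset.Icc 1 n, z k) atTop (𝓝 0) := by
  have hlim : Tendsto (fun n : ℕ => √(b n ^ 2 / n * (2 * ∑' m, a m))) atTop (𝓝 0) := by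
    simpa using (hb.tendsto_div_nhds_zero.mul_const (2 * ∑' m, a m)).sqrt
  refine squeeze_zero_norm' ((eventually_ge_atTop 1).mono fun n hn => Real.le_sqrt_of_sq_le ?_) hlim
  calc ‖(b n / n) • ∑ k ∈ Finset.Icc 1 n, z k‖ ^ 2
      = (b n / n) ^ 2 * ‖∑ k ∈ Finset.Icc 1 n, z k‖ ^ 2 := by
        rw [norm_smul, mul_pow, Real.norm_eq_abs, sq_abs]
    _ ≤ (b n / n) ^ 2 * (n * (2 * ∑' m, a m)) := by
        gcongr
        simpa using norm_sum_sq_le_of_inner_le ha hs h (Finset.Icc 1 n)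
    _ = b n ^ 2 / n * (2 * ∑' m, a m) := by
        field_simp

end WeakDependence

section Innovations

variable {Ω S : Type*} {δ δ' : ℤ → Ω → S}

theorem past_eq_elim (n : ℤ) :
    past δ n = fun ω (i : ℕ) => Sum.elim δ δ' (Sum.inl (n - i)) ω := rfl

theorem coupledPast_eq_elim (n : ℤ) (m : ℕ) :
    coupledPast δ δ' n m = fun ω (i : ℕ) =>
      Sum.elim δ δ' (if i < m then Sum.inl (n - i) else Sum.inr (n - i)) ω := by
  ext ω i
  rw [coupledPast]
  split_ifs <;> rfl

variable [MeasurableSpace S]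

theorem comap_elim_comp_le {ι : Type*} (φ : ι → ℤ ⊕ ℤ) :
    MeasurableSpace.comap (fun (ω : Ω) i => Sum.elim δ δ' (φ i) ω) MeasurableSpace.pi ≤
      ⨆ i ∈ Set.range φ, MeasurableSpace.comap (Sum.elim δ δ' i) inferInstance := by
  rw [MeasurableSpace.pi, MeasurableSpace.comap_iSup]
  refine iSup_le fun i => ?_
  rw [MeasurableSpace.comap_comp]
  exact le_iSup₂_of_le (φ i) ⟨i, rfl⟩ le_rfl

variable [MeasurableSpace Ω] {P : Measure Ω}

namespace IsIIDWithCopy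

theorem measurable_elim (h : IsIIDWithCopy P δ δ') : ∀ i, Measurable (Sum.elim δ δ' i)
  | .inl i => h.measurable i
  | .inr i => h.measurable_copy i

theorem map_elim (h : IsIIDWithCopy P δ δ') : ∀ i, P.map (Sum.elim δ δ' i) = P.map (δ 0)
  | .inl i => (h.identDistrib i).map_eq
  | .inr i => (h.identDistrib_copy i).map_eq

theorem identDistrib_subfamily (h : IsIIDWithCopy P δ δ') {ι : Type*} {φ ψ : ι → ℤ ⊕ ℤ}
    (hφ : Function.Injective φ) (hψ : Function.Injective ψ) :
    IdentDistrib (fun ω i => Sum.elim δ δ' (φ i) ω) (fun ω i => Sum.elim δ δ' (ψ i) ω) P P where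
  aemeasurable_fst := (measurable_pi_iff.2 fun i => h.measurable_elim (φ i)).aemeasurable
  aemeasurable_snd := (measurable_pi_iff.2 fun i => h.measurable_elim (ψ i)).aemeasurable
  map_eq := by
    rw [(h.indep.precomp hφ).map_fun_eq_infinitePi_map fun i => h.measurable_elim (φ i),
      (h.indep.precomp hψ).map_fun_eq_infinitePi_map fun i => h.measurable_elim (ψ i)]
    simp only [h.map_elim]

theorem indepFun_subfamily (h : IsIIDWithCopy P δ δ') {ι κ : Type*} {φ : ι → ℤ ⊕ ℤ}
    {ψ : κ → ℤ ⊕ ℤ} (hd : ∀ i j, φ i ≠ ψ j) :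
    IndepFun (fun ω i => Sum.elim δ δ' (φ i) ω) (fun ω j => Sum.elim δ δ' (ψ j) ω) P := by
  have hdisj : Disjoint (Set.range φ) (Set.range ψ) :=
    Set.disjoint_left.2 fun _ ⟨i, hi⟩ ⟨j, hj⟩ => hd i j (hi.trans hj.symm)
  have hindep := indep_iSup_of_disjoint (fun i => (h.measurable_elim i).comap_le)
    ((iIndepFun_iff_iIndep _ _ _).1 h.indep) hdisj
  rw [IndepFun_iff_Indep]
  exact indep_of_indep_of_le_left
    (indep_of_indep_of_le_right hindep (comap_elim_comp_le ψ)) (comap_elim_comp_le φ)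

theorem measurable_past (h : IsIIDWithCopy P δ δ') (n : ℤ) : Measurable (past δ n) :=
  measurable_pi_iff.2 fun _ => h.measurable _

theorem measurable_coupledPast (h : IsIIDWithCopy P δ δ') (n : ℤ) (m : ℕ) :
    Measurable (coupledPast δ δ' n m) := by
  rw [coupledPast_eq_elim]
  exact measurable_pi_iff.2 fun _ => h.measurable_elim _

theorem identDistrib_past (h : IsIIDWithCopy P δ δ') (n k : ℤ) :
    IdentDistrib (past δ n) (past δ k) P P := by
  rw [past_eq_elim (δ' := δ'), past_eq_elim (δ' := δ')]
  exact h.identDistrib_subfamily (fun i j hij => by simpa using hij)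
    (fun i j hij => by simpa using hij)

theorem identDistrib_coupledPast (h : IsIIDWithCopy P δ δ') (n : ℤ) (m : ℕ) (k : ℤ) :
    IdentDistrib (coupledPast δ δ' n m) (past δ k) P P := by
  rw [past_eq_elim (δ' := δ'), coupledPast_eq_elim]
  refine h.identDistrib_subfamily (fun i j hij => ?_) (fun i j hij => by simpa using hij)
  split_ifs at hij <;> simpa using hij

theorem indepFun_past_coupledPast (h : IsIIDWithCopy P δ δ') (k : ℤ) (m : ℕ) :
    IndepFun (past δ k) (coupledPast δ δ' (k + m) m) P := by
  rw [past_eq_elim (δ' := δ'), coupledPast_eq_elim]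
  refine h.indepFun_subfamily fun i j hij => ?_
  split_ifs at hij
  simp only [Sum.inl.injEq] at hij
  omega

theorem identDistrib_past_coupledPast (h : IsIIDWithCopy P δ δ') (n k : ℤ) (m : ℕ) :
    IdentDistrib (fun ω => (past δ n ω, coupledPast δ δ' n m ω))
      (fun ω => (past δ k ω, coupledPast δ δ' k m ω)) P P := by
  let u (d : ℤ ⊕ ℤ → S) : (ℕ → S) × (ℕ → S) :=
    (fun i => d (.inl i), fun i => d (if i < m then .inl i else .inr i))
  have hu : Measurable u := by fun_prop
  have hpair (s : ℤ) : (fun ω => (past δ s ω, coupledPast δ δ' s m ω)) =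
      u ∘ fun ω i => Sum.elim δ δ' (Sum.map (s - ·) (s - ·) i) ω := by
    ext ω i
    · rfl
    · simp only [u, coupledPast, Function.comp_apply]
      split_ifs <;> rfl
  have hinj (s : ℤ) : Function.Injective (Sum.map (s - ·) (s - ·) : ℤ ⊕ ℤ → ℤ ⊕ ℤ) :=
    sub_right_injective.sumMap sub_right_injective
  rw [hpair, hpair]
  exact (h.identDistrib_subfamily (hinj n) (hinj k)).comp hu

end IsIIDWithCopy

end Innovations

section BernoulliShift

variable {Ω S G : Type*} [MeasurableSpace Ω] [MeasurableSpace S] {P : Measure Ω}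
  {δ δ' : ℤ → Ω → S} [NormedAddCommGroup G] {F : (ℕ → S) → G} {p : ℝ≥0∞}

/-- The coupling error `ν_p(Z_m - Z_m^{(m)})` of the Bernoulli shift `Z_n = F(δ_n, δ_{n-1}, …)`. -/
noncomputable def couplingError (P : Measure Ω) (δ δ' : ℤ → Ω → S) (F : (ℕ → S) → G)
    (p : ℝ≥0∞) (m : ℕ) : ℝ≥0∞ :=
  eLpNorm (fun ω => F (past δ m ω) - F (coupledPast δ δ' m m ω)) p P

namespace IsIIDWithCopy

theorem memLp_past (h : IsIIDWithCopy P δ δ') (hF : StronglyMeasurable F) {n : ℤ}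
    (hp : MemLp (fun ω => F (past δ n ω)) p P) (k : ℤ) : MemLp (fun ω => F (past δ k ω)) p P := by
  borelize G
  exact ((h.identDistrib_past n k).comp hF.measurable).memLp_iff.1 hp

theorem memLp_coupledPast (h : IsIIDWithCopy P δ δ') (hF : StronglyMeasurable F) {n : ℤ}
    (hp : MemLp (fun ω => F (past δ n ω)) p P) (k : ℤ) (m : ℕ) :
    MemLp (fun ω => F (coupledPast δ δ' k m ω)) p P := by
  borelize G
  exact ((h.identDistrib_coupledPast k m n).comp hF.measurable).memLp_iff.2 hp

theorem eLpNorm_past (h : IsIIDWithCopy P δ δ') (hF : StronglyMeasurable F) (p : ℝ≥0∞)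
    (n k : ℤ) :
    eLpNorm (fun ω => F (past δ n ω)) p P = eLpNorm (fun ω => F (past δ k ω)) p P := by
  borelize G
  exact ((h.identDistrib_past n k).comp hF.measurable).eLpNorm_eq p

theorem eLpNorm_coupledPast (h : IsIIDWithCopy P δ δ') (hF : StronglyMeasurable F) (p : ℝ≥0∞)
    (n : ℤ) (m : ℕ) (k : ℤ) :
    eLpNorm (fun ω => F (coupledPast δ δ' n m ω)) p P = eLpNorm (fun ω => F (past δ k ω)) p P := by
  borelize G
  exact ((h.identDistrib_coupledPast n m k).comp hF.measurable).eLpNorm_eq p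

theorem eLpNorm_past_sub_coupledPast (h : IsIIDWithCopy P δ δ') (hF : StronglyMeasurable F)
    (p : ℝ≥0∞) (n : ℤ) (m : ℕ) :
    eLpNorm (fun ω => F (past δ n ω) - F (coupledPast δ δ' n m ω)) p P =
      couplingError P δ δ' F p m := by
  borelize G
  have hu : Measurable fun q : (ℕ → S) × (ℕ → S) => F q.1 - F q.2 :=
    ((hF.comp_measurable measurable_fst).sub (hF.comp_measurable measurable_snd)).measurable
  exact ((h.identDistrib_past_coupledPast n m m).comp hu).eLpNorm_eq p

theorem integral_past [NormedSpace ℝ G] (h : IsIIDWithCopy P δ δ') (hF : StronglyMeasurable F)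
    (n k : ℤ) : ∫ ω, F (past δ n ω) ∂P = ∫ ω, F (past δ k ω) ∂P := by
  borelize G
  exact ((h.identDistrib_past n k).comp hF.measurable).integral_eq

end IsIIDWithCopy

end BernoulliShift

section LawOfLargeNumbers

variable {Ω S G : Type*} [MeasurableSpace Ω] [MeasurableSpace S] {P : Measure Ω}
  {δ δ' : ℤ → Ω → S} [NormedAddCommGroup G] [InnerProductSpace ℝ G] {F : (ℕ → S) → G}

theorem inner_toLp {U V : Ω → G} (hU : MemLp U 2 P) (hV : MemLp V 2 P) :
    ⟪hU.toLp, hV.toLp⟫_ℝ = ∫ ω, ⟪U ω, V ω⟫_ℝ ∂P := by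
  rw [L2.inner_def]
  refine integral_congr_ae ?_
  filter_upwards [hU.coeFn_toLp, hV.coeFn_toLp] with ω h₁ h₂
  rw [h₁, h₂]

variable [CompleteSpace G]

namespace IsIIDWithCopy

theorem integral_inner_past_coupledPast (h : IsIIDWithCopy P δ δ') (hF : StronglyMeasurable F)
    (h1 : MemLp (fun ω => F (past δ 0 ω)) 1 P) (k : ℤ) (m : ℕ) :
    ∫ ω, ⟪F (past δ k ω), F (coupledPast δ δ' (k + m) m ω)⟫_ℝ ∂P =
      ⟪∫ ω, F (past δ k ω) ∂P, ∫ ω, F (coupledPast δ δ' (k + m) m ω) ∂P⟫_ℝ := by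
  have hp := (h.measurable_past k).aemeasurable (μ := P)
  have hc := (h.measurable_coupledPast (k + m) m).aemeasurable (μ := P)
  exact (h.indepFun_past_coupledPast k m).integral_bilin_comp_comp (f := F) (g := F) hp hc
    ((integrable_map_measure hF.aestronglyMeasurable hp).2
      (memLp_one_iff_integrable.1 (h.memLp_past hF h1 k)))
    ((integrable_map_measure hF.aestronglyMeasurable hc).2
      (memLp_one_iff_integrable.1 (h.memLp_coupledPast hF h1 (k + m) m))) (innerSL ℝ)

variable [IsProbabilityMeasure P]

-- The coupled variable at time `k + m` is independent of the one at time `k`, so replacing the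
-- former by its coupling error does not change the covariance.
theorem inner_toLp_past_le (h : IsIIDWithCopy P δ δ') (hF : StronglyMeasurable F)
    (h2 : MemLp (fun ω => F (past δ 0 ω)) 2 P) (h0 : ∫ ω, F (past δ 0 ω) ∂P = 0) (k m : ℕ) :
    ⟪(h.memLp_past hF h2 k).toLp, (h.memLp_past hF h2 (k + m : ℕ)).toLp⟫_ℝ ≤
      (eLpNorm (fun ω => F (past δ 0 ω)) 2 P).toReal * (couplingError P δ δ' F 2 m).toReal := by
  have hk := h.memLp_past hF h2 k
  have hkm := h.memLp_past hF h2 (k + m : ℕ)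
  have hc := h.memLp_coupledPast hF h2 (k + m : ℕ) m
  have horth : ⟪hk.toLp, hc.toLp⟫_ℝ = 0 := by
    rw [inner_toLp, Nat.cast_add,
      h.integral_inner_past_coupledPast hF (h2.mono_exponent one_le_two) k m,
      h.integral_past hF k 0, h0, inner_zero_left]
  calc ⟪hk.toLp, hkm.toLp⟫_ℝ = ⟪hk.toLp, (hkm.sub hc).toLp⟫_ℝ := by
        rw [MemLp.toLp_sub hkm hc, inner_sub_right, horth, sub_zero]
    _ ≤ ‖hk.toLp‖ * ‖(hkm.sub hc).toLp‖ := real_inner_le_norm _ _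
    _ = _ := by
        rw [Lp.norm_toLp, Lp.norm_toLp, h.eLpNorm_past hF 2 k 0]
        exact congrArg _ (congrArg _ (h.eLpNorm_past_sub_coupledPast hF 2 (k + m : ℕ) m))

theorem tendstoInMeasure_smul_sum (h : IsIIDWithCopy P δ δ') (hF : StronglyMeasurable F)
    (h2 : MemLp (fun ω => F (past δ 0 ω)) 2 P) (h0 : ∫ ω, F (past δ 0 ω) ∂P = 0)
    (hs : ∑' m, couplingError P δ δ' F 2 m ≠ ∞) {b : ℕ → ℝ}
    (hb : (fun n => b n ^ 2) =o[atTop] fun n => (n : ℝ)) :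
    TendstoInMeasure P (fun (n : ℕ) ω => (b n / n) • ∑ k ∈ Finset.Icc 1 n, F (past δ k ω)) atTop
      fun _ => 0 := by
  have hmem (n : ℕ) := h.memLp_past hF h2 n
  have hlim := tendsto_smul_sum_zero_of_inner_le
    (fun m => mul_nonneg ENNReal.toReal_nonneg ENNReal.toReal_nonneg)
    ((ENNReal.summable_toReal hs).mul_left _) (h.inner_toLp_past_le hF h2 h0) hb
  refine (tendstoInMeasure_of_tendsto_Lp hlim).congr (fun n => ?_) (Lp.coeFn_zero G 2 P)
  filter_upwards [Lp.coeFn_smul (b n / n) (∑ k ∈ Finset.Icc 1 n, (hmem k).toLp),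
    Lp.coeFn_finsetSum (Finset.Icc 1 n) fun k => (hmem k).toLp,
    ae_all_iff.2 fun k => (hmem k).coeFn_toLp] with ω h₁ h₂ h₃
  rw [h₁, Pi.smul_apply, h₂, Finset.sum_apply]
  simp only [h₃]

theorem tendstoInMeasure_smul_sum_sub_integral (h : IsIIDWithCopy P δ δ')
    (hF : StronglyMeasurable F) (h2 : MemLp (fun ω => F (past δ 0 ω)) 2 P)
    (hs : ∑' m, couplingError P δ δ' F 2 m ≠ ∞) {b : ℕ → ℝ}
    (hb : (fun n => b n ^ 2) =o[atTop] fun n => (n : ℝ)) :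
    TendstoInMeasure P (fun (n : ℕ) ω => (b n / n) •
      ∑ k ∈ Finset.Icc 1 n, (F (past δ k ω) - ∫ ω', F (past δ 0 ω') ∂P)) atTop fun _ => 0 := by
  refine h.tendstoInMeasure_smul_sum (F := fun q => F q - ∫ ω', F (past δ 0 ω') ∂P)
    (hF.sub stronglyMeasurable_const) (h2.sub (memLp_const _)) ?_ ?_ hb
  · rw [integral_sub (h2.integrable one_le_two) (integrable_const _), integral_const]
    simp
  · simpa only [couplingError, sub_sub_sub_cancel_right] using hs

end IsIIDWithCopy

end LawOfLargeNumbers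

section HilbertTensor

variable {H₁ H₂ : Type*} [NormedAddCommGroup H₁] [InnerProductSpace ℝ H₁]
  [NormedAddCommGroup H₂] [InnerProductSpace ℝ H₂]

variable (H₁ H₂) in
/-- The Hilbert space tensor product of `H₁` and `H₂`. Second moments of random operators
`X ⊗ Y` are computed here, since the operator norm does not come from an inner product. -/
abbrev HilbertTensor : Type _ := UniformSpace.Completion (H₁ ⊗[ℝ] H₂)

/-- The elementary tensor `x ⊗ y` as an element of the Hilbert space tensor product. -/
noncomputable def elemTensor (x : H₁) (y : H₂) : HilbertTensor H₁ H₂ :=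
  ((x ⊗ₜ[ℝ] y : H₁ ⊗[ℝ] H₂) : UniformSpace.Completion (H₁ ⊗[ℝ] H₂))

theorem norm_elemTensor (x : H₁) (y : H₂) : ‖elemTensor x y‖ = ‖x‖ * ‖y‖ := by
  rw [elemTensor, UniformSpace.Completion.norm_coe, TensorProduct.norm_tmul]

theorem continuous_elemTensor : Continuous fun q : H₁ × H₂ => elemTensor q.1 q.2 :=
  (UniformSpace.Completion.continuous_coe _).comp TensorProduct.continuous_tmul

theorem elemTensor_sub_elemTensor (x x' : H₁) (y y' : H₂) :
    elemTensor x y - elemTensor x' y' = elemTensor x (y - y') + elemTensor (x - x') y' := by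
  simp only [elemTensor, ← UniformSpace.Completion.coe_sub, ← UniformSpace.Completion.coe_add,
    TensorProduct.tmul_sub, TensorProduct.sub_tmul, sub_add_sub_cancel]

variable (H₁ H₂) in
/-- The linear extension of `tensor` to the algebraic tensor product. -/
noncomputable def tensorToOperator : H₁ ⊗[ℝ] H₂ →ₗ[ℝ] H₁ →L[ℝ] H₂ :=
  TensorProduct.lift <| LinearMap.mk₂ ℝ tensor
    (fun x x' y => by ext; simp [inner_add_left, add_smul])
    (fun c x y => by ext; simp [real_inner_smul_left, smul_smul])
    (fun x y y' => by ext; simp)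
    (fun c x y => by ext; simp [smul_smul, mul_comm])

theorem tensorToOperator_tmul (x : H₁) (y : H₂) :
    tensorToOperator H₁ H₂ (x ⊗ₜ y) = tensor x y := rfl

theorem tensorToOperator_apply_apply (z : H₁ ⊗[ℝ] H₂) (w : H₁) :
    tensorToOperator H₁ H₂ z w = TensorProduct.lid ℝ H₂ ((innerSL ℝ w).rTensor H₂ z) := by
  induction z using TensorProduct.induction_on with
  | zero => simp
  | tmul x y => simp [tensorToOperator_tmul, real_inner_comm]
  | add z z' hz hz' => rw [map_add, map_add, map_add, _root_.add_apply, hz, hz']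

theorem norm_tensorToOperator_le (z : H₁ ⊗[ℝ] H₂) : ‖tensorToOperator H₁ H₂ z‖ ≤ ‖z‖ := by
  refine ContinuousLinearMap.opNorm_le_bound _ (norm_nonneg z) fun w => ?_
  rw [tensorToOperator_apply_apply, TensorProduct.norm_lid, mul_comm]
  refine (ContinuousLinearMap.le_opNorm _ _).trans ?_
  gcongr
  exact (ContinuousLinearMap.norm_rTensor_le _ _).trans_eq (innerSL_apply_norm ℝ w)

variable [CompleteSpace H₂]

variable (H₁ H₂) in
/-- The continuous extension of `tensorToOperator` to the Hilbert space tensor product. -/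
noncomputable def hilbertTensorToOperator : HilbertTensor H₁ H₂ →L[ℝ] H₁ →L[ℝ] H₂ :=
  (tensorToOperator H₁ H₂).extendOfNorm
    (UniformSpace.Completion.toComplₗᵢ (𝕜 := ℝ) (E := H₁ ⊗[ℝ] H₂)).toLinearMap

theorem hilbertTensorToOperator_elemTensor (x : H₁) (y : H₂) :
    hilbertTensorToOperator H₁ H₂ (elemTensor x y) = tensor x y :=
  LinearMap.extendOfNorm_eq UniformSpace.Completion.denseRange_coe
    ⟨1, fun z => by simpa using norm_tensorToOperator_le z⟩ (x ⊗ₜ[ℝ] y)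

theorem smul_empCrossMoment_sub_eq_hilbertTensorToOperator {Ω : Type*} {X : ℕ → Ω → H₁}
    {Y : ℕ → Ω → H₂} {n : ℕ} (hn : 1 ≤ n) (ω : Ω) (μ : HilbertTensor H₁ H₂) (b : ℝ) :
    b • (empCrossMoment X Y n ω - hilbertTensorToOperator H₁ H₂ μ) =
      hilbertTensorToOperator H₁ H₂ ((b / n) •
        ∑ k ∈ Finset.Icc 1 n, (elemTensor (X k ω) (Y k ω) - μ)) := by
  have hn0 : (n : ℝ) ≠ 0 := by positivity
  simp only [empCrossMoment, map_smul, map_sum, map_sub, hilbertTensorToOperator_elemTensor,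
    Finset.sum_sub_distrib, Finset.sum_const, Nat.card_Icc, Nat.add_sub_cancel, smul_sub,
    smul_smul, ← Nat.cast_smul_eq_nsmul ℝ, div_eq_mul_inv, inv_mul_cancel_right₀ hn0]

end HilbertTensor

section Products

variable {Ω S H₁ H₂ : Type*} [MeasurableSpace Ω] [NormedAddCommGroup H₁] [InnerProductSpace ℝ H₁]
  [NormedAddCommGroup H₂] [InnerProductSpace ℝ H₂] {P : Measure Ω} {p q r : ℝ≥0∞}
  [p.HolderTriple q r]

theorem eLpNorm_elemTensor_le {x : Ω → H₁} {y : Ω → H₂} (hx : AEStronglyMeasurable x P)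
    (hy : AEStronglyMeasurable y P) :
    eLpNorm (fun ω => elemTensor (x ω) (y ω)) r P ≤ eLpNorm x p P * eLpNorm y q P := by
  simpa using eLpNorm_le_eLpNorm_mul_eLpNorm'_of_norm hx hy elemTensor 1
    (ae_of_all _ fun ω => by simp [norm_elemTensor])

theorem aestronglyMeasurable_elemTensor {x : Ω → H₁} {y : Ω → H₂}
    (hx : AEStronglyMeasurable x P) (hy : AEStronglyMeasurable y P) :
    AEStronglyMeasurable (fun ω => elemTensor (x ω) (y ω)) P :=
  Continuous.comp_aestronglyMeasurable₂ (g := elemTensor) continuous_elemTensor hx hy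

theorem memLp_elemTensor {x : Ω → H₁} {y : Ω → H₂} (hx : MemLp x p P) (hy : MemLp y q P) :
    MemLp (fun ω => elemTensor (x ω) (y ω)) r P :=
  ⟨aestronglyMeasurable_elemTensor hx.1 hy.1,
    (eLpNorm_elemTensor_le hx.1 hy.1).trans_lt (ENNReal.mul_lt_top hx.2 hy.2)⟩

variable [MeasurableSpace S] {δ δ' : ℤ → Ω → S} {f : (ℕ → S) → H₁} {g : (ℕ → S) → H₂}

theorem couplingError_elemTensor_le (hδ : IsIIDWithCopy P δ δ') (hf : StronglyMeasurable f)
    (hg : StronglyMeasurable g) (hr : 1 ≤ r) (m : ℕ) :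
    couplingError P δ δ' (fun s => elemTensor (f s) (g s)) r m ≤
      eLpNorm (fun ω => f (past δ 0 ω)) p P * couplingError P δ δ' g q m +
        couplingError P δ δ' f p m * eLpNorm (fun ω => g (past δ 0 ω)) q P := by
  have mf := (hf.comp_measurable (hδ.measurable_past m)).aestronglyMeasurable (μ := P)
  have mg := (hg.comp_measurable (hδ.measurable_past m)).aestronglyMeasurable (μ := P)
  have mf' := (hf.comp_measurable (hδ.measurable_coupledPast m m)).aestronglyMeasurable (μ := P)
  have mg' := (hg.comp_measurable (hδ.measurable_coupledPast m m)).aestronglyMeasurable (μ := P)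
  simp only [couplingError, elemTensor_sub_elemTensor]
  rw [hδ.eLpNorm_past hf p 0 m, ← hδ.eLpNorm_coupledPast hg q m m 0]
  refine (eLpNorm_add_le
    (aestronglyMeasurable_elemTensor mf (mg.sub mg'))
    (aestronglyMeasurable_elemTensor (mf.sub mf') mg') hr).trans ?_
  exact add_le_add (eLpNorm_elemTensor_le mf (mg.sub mg'))
    (eLpNorm_elemTensor_le (mf.sub mf') mg')

end Products

section Approximable

variable {Ω E S : Type*} [MeasurableSpace Ω] [MeasurableSpace S]
  [NormedAddCommGroup E] [TopologicalSpace.SeparableSpace E] [MeasurableSpace E] [BorelSpace E]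
  {P : Measure Ω} {δ δ' : ℤ → Ω → S} {f : (ℕ → S) → E} {X : ℕ → Ω → E} {p : ℝ≥0∞}

namespace IsLpmApproximable

theorem stronglyMeasurable (hX : IsLpmApproximable P p δ δ' f X) : StronglyMeasurable f := by
  have := UniformSpace.secondCountable_of_separable E
  exact hX.measurable.stronglyMeasurable

theorem memLp_past (hX : IsLpmApproximable P p δ δ' f X) (hδ : IsIIDWithCopy P δ δ') (k : ℤ) :
    MemLp (fun ω => f (past δ k ω)) p P :=
  hδ.memLp_past hX.stronglyMeasurable ((memLp_congr_ae (hX.repr 1 le_rfl)).1 (hX.memLp 1 le_rfl)) k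

theorem tsum_couplingError_ne_top (hX : IsLpmApproximable P p δ δ' f X)
    (hδ : IsIIDWithCopy P δ δ') : ∑' m, couplingError P δ δ' f p m ≠ ∞ := by
  have hf := hX.stronglyMeasurable
  have hsucc (i : ℕ) : couplingError P δ δ' f p (i + 1) =
      eLpNorm (fun ω => X (i + 1) ω - f (coupledPast δ δ' ((i + 1 : ℕ) : ℤ) (i + 1) ω)) p P :=
    eLpNorm_congr_ae <| (hX.repr (i + 1) (Nat.le_add_left 1 i)).mono fun ω hω => by
      simp only [hω]
  have hzero : couplingError P δ δ' f p 0 < ∞ :=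
    ((hX.memLp_past hδ 0).sub (hδ.memLp_coupledPast hf (hX.memLp_past hδ 0) 0 0)).2
  rw [tsum_eq_zero_add' ENNReal.summable]
  simp only [hsucc]
  exact (ENNReal.add_lt_top.2 ⟨hzero, hX.summable⟩).ne

end IsLpmApproximable

end Approximable

section CrossMoment

variable {Ω H₁ H₂ S : Type*} [MeasurableSpace Ω] [MeasurableSpace S]
  [NormedAddCommGroup H₁] [InnerProductSpace ℝ H₁]
  [TopologicalSpace.SeparableSpace H₁] [MeasurableSpace H₁] [BorelSpace H₁]
  [NormedAddCommGroup H₂] [InnerProductSpace ℝ H₂]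
  [TopologicalSpace.SeparableSpace H₂] [MeasurableSpace H₂] [BorelSpace H₂]
  {P : Measure Ω} {p q : ℝ≥0∞} [p.HolderTriple q 2] {δ δ' : ℤ → Ω → S}
  {f : (ℕ → S) → H₁} {X : ℕ → Ω → H₁} {g : (ℕ → S) → H₂} {Y : ℕ → Ω → H₂}

theorem tsum_couplingError_elemTensor_ne_top (hδ : IsIIDWithCopy P δ δ')
    (hX : IsLpmApproximable P p δ δ' f X) (hY : IsLpmApproximable P q δ δ' g Y) :
    ∑' m, couplingError P δ δ' (fun s => elemTensor (f s) (g s)) 2 m ≠ ∞ := by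
  refine ne_top_of_le_ne_top ?_ (ENNReal.tsum_le_tsum fun m =>
    couplingError_elemTensor_le (p := p) (q := q) hδ hX.stronglyMeasurable hY.stronglyMeasurable
      one_le_two m)
  rw [ENNReal.tsum_add, ENNReal.tsum_mul_left, ENNReal.tsum_mul_right]
  exact ENNReal.add_ne_top.2
    ⟨ENNReal.mul_ne_top (hX.memLp_past hδ 0).2.ne (hY.tsum_couplingError_ne_top hδ),
      ENNReal.mul_ne_top (hX.tsum_couplingError_ne_top hδ) (hY.memLp_past hδ 0).2.ne⟩

variable [CompleteSpace H₂]

theorem crossMoment_eq_hilbertTensorToOperator [IsFiniteMeasure P] (hδ : IsIIDWithCopy P δ δ')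
    (hX : IsLpmApproximable P p δ δ' f X) (hY : IsLpmApproximable P q δ δ' g Y) :
    crossMoment P (X 1) (Y 1) = hilbertTensorToOperator H₁ H₂
      (∫ ω, elemTensor (f (past δ 0 ω)) (g (past δ 0 ω)) ∂P) := by
  have hm : StronglyMeasurable fun s => elemTensor (f s) (g s) :=
    continuous_elemTensor.comp_stronglyMeasurable
      (hX.stronglyMeasurable.prodMk hY.stronglyMeasurable)
  have hmem : MemLp (fun ω => elemTensor (f (past δ 1 ω)) (g (past δ 1 ω))) 2 P :=
    memLp_elemTensor (hX.memLp_past hδ 1) (hY.memLp_past hδ 1)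
  rw [hδ.integral_past hm 0 1,
    ← ContinuousLinearMap.integral_comp_comm _ (hmem.integrable one_le_two), crossMoment]
  refine integral_congr_ae ?_
  filter_upwards [hX.repr 1 le_rfl, hY.repr 1 le_rfl] with ω h₁ h₂
  rw [hilbertTensorToOperator_elemTensor, h₁, h₂, Nat.cast_one]

theorem tendsto_smul_empCrossMoment_sub [IsProbabilityMeasure P] (hδ : IsIIDWithCopy P δ δ')
    (hX : IsLpmApproximable P p δ δ' f X) (hY : IsLpmApproximable P q δ δ' g Y)
    {b : ℕ → ℝ} (hb : (fun n => b n ^ 2) =o[atTop] fun n => (n : ℝ)) :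
    Tendsto (fun i : ℕ × Ω =>
        b i.1 • (empCrossMoment X Y i.1 i.2 - crossMoment P (X 1) (Y 1)))
      (inProbability P atTop) (𝓝 0) := by
  have hm : StronglyMeasurable fun s => elemTensor (f s) (g s) :=
    continuous_elemTensor.comp_stronglyMeasurable
      (hX.stronglyMeasurable.prodMk hY.stronglyMeasurable)
  have hlln := hδ.tendstoInMeasure_smul_sum_sub_integral hm
    (memLp_elemTensor (hX.memLp_past hδ 0) (hY.memLp_past hδ 0))
    (tsum_couplingError_elemTensor_ne_top hδ hX hY) hb
  have hlim := ((hilbertTensorToOperator H₁ H₂).continuous.tendsto 0).comp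
    (tendsto_inProbability_iff.2 hlln)
  rw [map_zero] at hlim
  refine hlim.congr' (eventually_inProbability_of_ae ?_)
  filter_upwards [eventually_ge_atTop 1] with n hn
  filter_upwards [ae_all_iff.2 fun k => ae_all_iff.2 (hX.repr k),
    ae_all_iff.2 fun k => ae_all_iff.2 (hY.repr k)] with ω hω₁ hω₂
  rw [crossMoment_eq_hilbertTensorToOperator hδ hX hY]
  rw [smul_empCrossMoment_sub_eq_hilbertTensorToOperator hn]
  refine congrArg (fun z => hilbertTensorToOperator H₁ H₂ ((b n / n) • z))
    (Finset.sum_congr rfl fun k hk => ?_)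
  rw [hω₁ k (Finset.mem_Icc.1 hk).1, hω₂ k (Finset.mem_Icc.1 hk).1]

end CrossMoment

section Covariance

variable {Ω H₁ H₂ : Type*}
  [NormedAddCommGroup H₁] [InnerProductSpace ℝ H₁]
  [NormedAddCommGroup H₂] [InnerProductSpace ℝ H₂]

theorem isPositive_tensor_self (x : H₁) : (tensor x x).IsPositive :=
  InnerProductSpace.isPositive_rankOne_self x

theorem continuous_tensor : Continuous fun q : H₁ × H₂ => tensor q.1 q.2 :=
  (ContinuousLinearMap.smulRightL ℝ H₁ H₂).continuous₂.comp
    (((innerSL ℝ).continuous.comp continuous_fst).prodMk continuous_snd)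

theorem isCompactOperator_empCrossMoment (X : ℕ → Ω → H₁) (Y : ℕ → Ω → H₂) (n : ℕ) (ω : Ω) :
    IsCompactOperator (empCrossMoment X Y n ω) :=
  (compactOperator (RingHom.id ℝ) H₁ H₂).smul_mem _
    (Submodule.sum_mem _ fun k _ => isCompactOperator_tensor (X k ω) (Y k ω))

theorem isPositive_empCrossMoment_self (X : ℕ → Ω → H₁) (n : ℕ) (ω : Ω) :
    (empCrossMoment X X n ω).IsPositive :=
  (ContinuousLinearMap.isPositive_sum _ fun k _ => isPositive_tensor_self (X k ω)).smul_of_nonneg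
    (by positivity)

theorem empCrossMoment_sub_comp_empCrossMoment {X : ℕ → Ω → H₁} {Y ε : ℕ → Ω → H₂}
    {Ψ : H₁ →L[ℝ] H₂} {ω : Ω} (h : ∀ k, 1 ≤ k → Y k ω = Ψ (X k ω) + ε k ω) (n : ℕ) :
    empCrossMoment X Y n ω - Ψ ∘L empCrossMoment X X n ω = empCrossMoment X ε n ω := by
  rw [sub_eq_iff_eq_add']
  ext x
  simp only [empCrossMoment, _root_.add_apply, ContinuousLinearMap.comp_apply, _root_.smul_apply,
    _root_.sum_apply, tensor_apply, map_smul, map_sum, ← smul_add, ← Finset.sum_add_distrib]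
  refine congrArg _ (Finset.sum_congr rfl fun k hk => ?_)
  rw [h k (Finset.mem_Icc.1 hk).1]

variable [MeasurableSpace Ω] {P : Measure Ω}

theorem covOp_eq_crossMoment_self {X : Ω → H₁} (hX : ∫ ω, X ω ∂P = 0) :
    covOp P X = crossMoment P X X := by
  simp [covOp, hX]

theorem integrable_tensor {X : Ω → H₁} {Y : Ω → H₂} (hX : MemLp X 2 P) (hY : MemLp Y 2 P) :
    Integrable (fun ω => tensor (X ω) (Y ω)) P := by
  have hm : AEStronglyMeasurable (fun ω => tensor (X ω) (Y ω)) P :=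
    Continuous.comp_aestronglyMeasurable₂ (g := tensor) continuous_tensor hX.1 hY.1
  refine (hX.norm.integrable_mul hY.norm).mono' hm (ae_of_all _ fun ω => ?_)
  rw [norm_tensor, Pi.mul_apply]

theorem isCompactOperator_crossMoment [CompleteSpace H₂] [IsProbabilityMeasure P] {X : Ω → H₁}
    {Y : Ω → H₂} (hX : MemLp X 2 P) (hY : MemLp Y 2 P) :
    IsCompactOperator (crossMoment P X Y) :=
  Convex.integral_mem (s := {T : H₁ →L[ℝ] H₂ | IsCompactOperator T})
    (compactOperator (RingHom.id ℝ) H₁ H₂).convex isClosed_setOfPred_isCompactOperator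
    (ae_of_all _ fun _ => isCompactOperator_tensor _ _) (integrable_tensor hX hY)

variable [CompleteSpace H₁] {X : Ω → H₁}

theorem inner_crossMoment_self_apply (hX : MemLp X 2 P) (x y : H₁) :
    ⟪crossMoment P X X x, y⟫_ℝ = ∫ ω, ⟪X ω, x⟫_ℝ * ⟪X ω, y⟫_ℝ ∂P := by
  have hInt := integrable_tensor hX hX
  rw [crossMoment, ContinuousLinearMap.integral_apply hInt, real_inner_comm,
    ← integral_inner (hInt.apply_continuousLinearMap x)]
  refine integral_congr_ae (ae_of_all _ fun ω => ?_)
  simp [real_inner_smul_right, real_inner_comm y]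

theorem isPositive_crossMoment_self (hX : MemLp X 2 P) : (crossMoment P X X).IsPositive := by
  rw [ContinuousLinearMap.isPositive_iff]
  refine ⟨fun x y => ?_, fun x => ?_⟩
  · simp only [ContinuousLinearMap.coe_coe]
    rw [← real_inner_comm x, inner_crossMoment_self_apply hX, inner_crossMoment_self_apply hX]
    exact integral_congr_ae (ae_of_all _ fun ω => mul_comm _ _)
  · rw [inner_crossMoment_self_apply hX]
    exact integral_nonneg fun ω => mul_self_nonneg _

end Covariance

instance holderTriple_four_four_two : ENNReal.HolderTriple 4 4 2 :=
  ⟨by rw [← two_mul, show (4 : ℝ≥0∞) = 2 * 2 by norm_num,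
    ENNReal.mul_inv (by simp) (by simp), ← mul_assoc,
    ENNReal.mul_inv_cancel (by simp) (by simp), one_mul]⟩

theorem isLittleO_pow_of_le {ι : Type*} {l : Filter ι} {m u : ι → ℝ} {j k : ℕ}
    (hm : Tendsto m l atTop) (hjk : j ≤ k) (h : (fun i => m i ^ k) =o[l] u) :
    (fun i => m i ^ j) =o[l] u := by
  refine IsBigO.trans_isLittleO (IsBigO.of_bound 1 ?_) h
  filter_upwards [hm.eventually_ge_atTop 1] with i hi
  rw [one_mul, norm_pow, norm_pow]
  exact pow_le_pow_right₀ (hi.trans (Real.le_norm_self _)) hjk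

section Estimator

variable {Ω H₁ H₂ S : Type*} [MeasurableSpace Ω] [MeasurableSpace S]
  [NormedAddCommGroup H₁] [InnerProductSpace ℝ H₁]
  [TopologicalSpace.SeparableSpace H₁] [MeasurableSpace H₁] [BorelSpace H₁]
  [NormedAddCommGroup H₂] [InnerProductSpace ℝ H₂] [CompleteSpace H₂]
  [TopologicalSpace.SeparableSpace H₂] [MeasurableSpace H₂] [BorelSpace H₂]
  {P : Measure Ω} [IsProbabilityMeasure P] {p q : ℝ≥0∞} [p.HolderTriple q 2] {δ δ' : ℤ → Ω → S}
  {f : (ℕ → S) → H₁} {X : ℕ → Ω → H₁} {g : (ℕ → S) → H₂} {Y ε : ℕ → Ω → H₂}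

theorem tendsto_empCrossMoment (hδ : IsIIDWithCopy P δ δ')
    (hX : IsLpmApproximable P p δ δ' f X) (hY : IsLpmApproximable P q δ δ' g Y) :
    Tendsto (fun i : ℕ × Ω => empCrossMoment X Y i.1 i.2) (inProbability P atTop)
      (𝓝 (crossMoment P (X 1) (Y 1))) := by
  have hone : (fun _ : ℕ => (1 : ℝ) ^ 2) =o[atTop] fun n => (n : ℝ) := by
    simp only [one_pow]
    exact (isLittleO_const_id_atTop (1 : ℝ)).comp_tendsto tendsto_natCast_atTop_atTop
  have h := tendsto_smul_empCrossMoment_sub hδ hX hY hone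
  simp only [one_smul] at h
  exact tendsto_sub_nhds_zero_iff.1 h

theorem tendsto_smul_empCrossMoment_sub_comp {Ψ : H₁ →L[ℝ] H₂} {b : ℕ → ℝ}
    (hδ : IsIIDWithCopy P δ δ')
    (hX : IsLpmApproximable P p δ δ' f X) (hε : IsLpmApproximable P q δ δ' g ε)
    (horth : crossMoment P (X 1) (ε 1) = 0)
    (hmodel : ∀ k, 1 ≤ k → ∀ᵐ ω ∂P, Y k ω = Ψ (X k ω) + ε k ω)
    (hb : (fun n => b n ^ 2) =o[atTop] fun n => (n : ℝ)) :
    Tendsto (fun i : ℕ × Ω =>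
        b i.1 • (empCrossMoment X Y i.1 i.2 - Ψ ∘L empCrossMoment X X i.1 i.2))
      (inProbability P atTop) (𝓝 0) := by
  have h := tendsto_smul_empCrossMoment_sub hδ hX hε hb
  simp only [horth, sub_zero] at h
  refine h.congr' (eventually_inProbability_of_ae (Eventually.of_forall fun n => ?_))
  filter_upwards [ae_all_iff.2 fun k => ae_all_iff.2 (hmodel k)] with ω hω
  rw [empCrossMoment_sub_comp_empCrossMoment hω]

end Estimator

end HilbertLM

theorem theorem1_general
    {Ω H₁ H₂ S : Type*} [MeasurableSpace Ω] [MeasurableSpace S]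
    [NormedAddCommGroup H₁] [InnerProductSpace ℝ H₁] [CompleteSpace H₁]
    [TopologicalSpace.SeparableSpace H₁] [MeasurableSpace H₁] [BorelSpace H₁]
    [NormedAddCommGroup H₂] [InnerProductSpace ℝ H₂] [CompleteSpace H₂]
    [TopologicalSpace.SeparableSpace H₂] [MeasurableSpace H₂] [BorelSpace H₂]
    (P : Measure Ω) [IsProbabilityMeasure P]
    (Ψ : H₁ →L[ℝ] H₂) (hΨ : IsCompactOperator Ψ) (X : ℕ → Ω → H₁) (ε Y : ℕ → Ω → H₂)
    (hmodel : ∀ k, 1 ≤ k → ∀ᵐ ω ∂P, Y k ω = Ψ (X k ω) + ε k ω)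
    (δ δ' : ℤ → Ω → S) (hδ : HilbertLM.IsIIDWithCopy P δ δ')
    (f : (ℕ → S) → H₁) (hX : HilbertLM.IsLpmApproximable P 4 δ δ' f X)
    (g : (ℕ → S) → H₂) (hε : HilbertLM.IsLpmApproximable P 4 δ δ' g ε)
    (horth : HilbertLM.crossMoment P (X 1) (ε 1) = 0)
    (hrange : DenseRange (HilbertLM.crossMoment P (X 1) (X 1)))
    (lam : ℕ → ℝ) (v : ℕ → H₁)
    (hlam : HilbertLM.IsEigenSystem (HilbertLM.crossMoment P (X 1) (X 1)) lam v)
    (hdist : Function.Injective lam)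
    (lamHat : ℕ → Ω → ℕ → ℝ) (vHat : ℕ → Ω → ℕ → H₁)
    (hHat : ∀ n, 1 ≤ n → ∀ ω,
      HilbertLM.IsEigenSystem (HilbertLM.empCrossMoment X X n ω) (lamHat n ω) (vHat n ω))
    (m : ℕ → ℝ) (hm : Tendsto m atTop atTop)
    (hm2 : (fun n => m n ^ 2) =o[atTop] (fun n => (n : ℝ))) :
    TendstoInMeasure P
      (fun n ω =>
        ‖HilbertLM.pcaOperator (HilbertLM.empCrossMoment X Y n ω) (lamHat n ω) (vHat n ω)
            (HilbertLM.truncK (lamHat n ω) (m n)) - Ψ‖)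
      atTop (fun _ => (0 : ℝ)) := by
  open HilbertLM in
  have hX2 : MemLp (X 1) 2 P := (hX.memLp 1 le_rfl).mono_exponent (by norm_num)
  have hT : ∀ᶠ i in inProbability P atTop,
      IsEigenSystem (empCrossMoment X X i.1 i.2) (lamHat i.1 i.2) (vHat i.1 i.2) :=
    eventually_inProbability_of_ae <| (eventually_ge_atTop 1).mono fun n hn =>
      ae_of_all _ (hHat n hn)
  have hlim := tendsto_pcaOperator_truncK hlam (isPositive_crossMoment_self hX2)
    (isCompactOperator_crossMoment hX2 hX2) hdist hrange hT
    (fun i => isPositive_empCrossMoment_self X i.1 i.2)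
    (fun i => isCompactOperator_empCrossMoment X X i.1 i.2)
    (tendsto_empCrossMoment hδ hX hX) (hm.comp tendsto_fst_inProbability) hΨ
    (tendsto_smul_empCrossMoment_sub_comp hδ hX hε horth hmodel hm2)
  exact tendsto_inProbability_iff.1 (tendsto_iff_norm_sub_tendsto_zero.1 hlim)

theorem theorem1
    {Ω H₁ H₂ S : Type*} [MeasurableSpace Ω] [MeasurableSpace S]
    [NormedAddCommGroup H₁] [InnerProductSpace ℝ H₁] [CompleteSpace H₁]
    [TopologicalSpace.SeparableSpace H₁] [MeasurableSpace H₁] [BorelSpace H₁]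
    [NormedAddCommGroup H₂] [InnerProductSpace ℝ H₂] [CompleteSpace H₂]
    [TopologicalSpace.SeparableSpace H₂] [MeasurableSpace H₂] [BorelSpace H₂]
    (hdim : ¬ FiniteDimensional ℝ H₁)
    (P : Measure Ω) [IsProbabilityMeasure P]
    -- the model
    (Ψ : H₁ →L[ℝ] H₂) (X : ℕ → Ω → H₁) (ε Y : ℕ → Ω → H₂)
    (hmodel : ∀ k, 1 ≤ k → ∀ᵐ ω ∂P, Y k ω = Ψ (X k ω) + ε k ω)
    -- moments and dependence
    (hX0 : ∀ k, 1 ≤ k → ∫ ω, X k ω ∂P = 0)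
    (hε0 : ∀ k, 1 ≤ k → ∫ ω, ε k ω ∂P = 0)
    (δ δ' : ℤ → Ω → S) (hδ : HilbertLM.IsIIDWithCopy P δ δ')
    (f : (ℕ → S) → H₁) (hX : HilbertLM.IsLpmApproximable P 4 δ δ' f X)
    (g : (ℕ → S) → H₂) (hε : HilbertLM.IsLpmApproximable P 4 δ δ' g ε)
    (hwn : HilbertLM.IsWhiteNoise P ε)
    (horth : ∀ k, 1 ≤ k → HilbertLM.Orthogonal P (X k) (ε k))
    -- the covariance operator has full rank and mutually distinct eigenvalues
    (hrank : DenseRange (HilbertLM.covOp P (X 1)))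
    (lam : ℕ → ℝ) (v : ℕ → H₁)
    (hlam : HilbertLM.IsEigenSystem (HilbertLM.covOp P (X 1)) lam v)
    (hdist : Function.Injective lam)
    (hΨ : HilbertLM.IsHilbertSchmidt Ψ)
    -- any choice of the empirical eigenelements
    (lamHat : ℕ → Ω → ℕ → ℝ) (vHat : ℕ → Ω → ℕ → H₁)
    (hHat : ∀ n, 1 ≤ n → ∀ ω,
      HilbertLM.IsEigenSystem (HilbertLM.empCrossMoment X X n ω) (lamHat n ω) (vHat n ω))
    -- the tuning parameter
    (m : ℕ → ℝ) (hm : Tendsto m atTop atTop)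
    (hm6 : (fun n => m n ^ 6) =o[atTop] (fun n => (n : ℝ))) :
    TendstoInMeasure P
      (fun n ω =>
        ‖HilbertLM.pcaOperator (HilbertLM.empCrossMoment X Y n ω) (lamHat n ω) (vHat n ω)
            (HilbertLM.truncK (lamHat n ω) (m n)) - Ψ‖)
      atTop (fun _ => (0 : ℝ)) := by
  open HilbertLM in
  have hcov : covOp P (X 1) = crossMoment P (X 1) (X 1) :=
    covOp_eq_crossMoment_self (hX0 1 le_rfl)
  rw [hcov] at hrank hlam
  exact theorem1_general P Ψ hΨ.isCompactOperator X ε Y hmodel δ δ' hδ f hX g hε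
    (horth 1 le_rfl).2.2 hrank lam v hlam hdist lamHat vHat hHat m hm
    (isLittleO_pow_of_le hm (by norm_num) hm6)
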